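/- Let $\mathscr{E}$ be the ring of germs at the origin of smooth functions $(x,\lambda)\mapsto f(x,\lambda)\in\mathbb{R}$ on $\mathbb{R}^2$, let $\mathcal{M}=\langle x,\lambda\rangle\subset\mathscr{E}$, and fix a local order $\prec$ on monomials (a total order compatible with multiplication, with $x\prec1$ and $\lambda\prec 1$). $\mathrm{Terms}(f)$ is the set of nonzero terms $a_{ij}x^i\lambda^j$ of the Taylor expansion of $f$ at $0$; $LT(f)$ is its $\prec$-largest element, with $LT(f)=0$ if $f$ is flat. A finite set $G$ is a standard basis of an ideal $I$ if $G$ generates $I$ and $\langle LT(f): f\in I\rangle=\langle LT(g): g\in G\rangle$. It is reduced if every leading coefficient is $1$ and, for $g,h\in G$ and $p\in\mathrm{Terms}(h)$, $LT(g)\mid p$ only if $g=h$ and $p=LT(g)$; it is monomial if its elements are monomials $x^a\lambda^b$. A vector subspace $V\subseteq\mathscr{E}$ (for instance an ideal) has finite codimension if $\mathcal{M}^k\subseteq V$ for some $k$. An ideal $I$ is intrinsic if $h\in I$ implies $S(x,\lambda)\,h(X(x,\lambda),\lambda)\in I$ for all smooth germs $S,X$ with $S>0$, $X_x>0$ and $X(0,0)=0$.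 $\mathrm{Itr}(V)$ is the largest intrinsic ideal contained in the vector subspace $V$. 1. Let $I$ be an intrinsic ideal that has finite codimension or, more generally, is generated by monomials. Then $I=\sum_i\mathcal{M}^{m_i}\langle\lambda^{n_i}\rangle$ for a finite (possibly empty) family of nonnegative integers with $n_i$ strictly increasing and $m_i+n_i$ strictly decreasing, where some $n_i$ is $0$ if $I$ has finite codimension; and $I$ has a reduced monomial standard basis that contains its intrinsic generators, that is, all the monomials $x^{m_i}\lambda^{n_i}$ of such a representation. 2. Let $V$ be a vector subspace of $\mathscr{E}$ of finite codimension. Then there are a reduced monomial standard basis $\{f_j\}$ of $\mathrm{Itr}(V)$ and finitely many $g_1,\dots,g_r\in\mathscr{E}$ with $V=\mathrm{Itr}(V)+\langle g_1,\dots,g_r\rangle_{\mathbb{R}}$ such that no term of any $g_i$ is divisible by any $f_j$, and $\mathrm{Itr}(V)\cap\bigcup_i\mathrm{Terms}(g_i)=\emptyset$. 3. Let $I$ be a finitely generated ideal of $\mathscr{E}$. Then there are finitely many monomials $f_j$ and finitely many $g_1,\dots,g_r\in\mathscr{E}$ with $I=\mathrm{Itr}(I)+\langle g_1,\dots,g_r\rangle_{\mathscr{E}}$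 such that no term of any $g_i$ is divisible by any $f_j$, and $\mathrm{Itr}(I)\cap\bigcup_i\mathrm{Terms}(g_i)=\emptyset$. Here $\{f_j\}$ is a reduced monomial standard basis of the ideal generated by the monomials in $\mathrm{Itr}(I)$, and it is a reduced monomial standard basis of $\mathrm{Itr}(I)$ itself if $I$ has finite codimension or $\mathrm{Itr}(I)$ is generated by monomials. -/

import Mathlib

open Filter Topology
open scoped ContDiff Nat

noncomputable section

namespace SingularityGerms

/-! ### The ring of smooth germs in two variables `(x, l)` at the origin -/

/-- `f` is smooth on a neighbourhood of the origin. -/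
def SmoothNearZero (f : ℝ × ℝ → ℝ) : Prop := ∀ᶠ p in 𝓝 (0 : ℝ × ℝ), ContDiffAt ℝ ∞ f p

/-- The ring of germs at the origin of smooth functions of `(x, l)`, as a subring of the ring of
all germs of functions at the origin. -/
def smoothGermSubring : Subring (Germ (𝓝 (0 : ℝ × ℝ)) ℝ) where
  carrier := {g | ∃ f : ℝ × ℝ → ℝ, SmoothNearZero f ∧ (f : Germ (𝓝 (0 : ℝ × ℝ)) ℝ) = g}
  mul_mem' := by
    rintro _ _ ⟨f, hf, rfl⟩ ⟨g, hg, rfl⟩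
    exact ⟨f * g, by filter_upwards [hf, hg] with p h1 h2 using h1.mul h2, rfl⟩
  one_mem' := ⟨1, Eventually.of_forall fun _ => contDiffAt_const, rfl⟩
  add_mem' := by
    rintro _ _ ⟨f, hf, rfl⟩ ⟨g, hg, rfl⟩
    exact ⟨f + g, by filter_upwards [hf, hg] with p h1 h2 using h1.add h2, rfl⟩
  zero_mem' := ⟨0, Eventually.of_forall fun _ => contDiffAt_const, rfl⟩
  neg_mem' := by
    rintro _ ⟨f, hf, rfl⟩
    exact ⟨-f, by filter_upwards [hf] with p h1 using h1.neg, rfl⟩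

/-- Smooth germs at the origin of `ℝ × ℝ`. -/
abbrev SmoothGerm : Type := smoothGermSubring

/-- The germ of a function which is smooth near the origin. -/
def germOf (f : ℝ × ℝ → ℝ) (hf : SmoothNearZero f) : SmoothGerm := ⟨f, f, hf, rfl⟩

/-- Real numbers as constant germs. -/
def constGerm : ℝ →+* SmoothGerm where
  toFun c := germOf (fun _ => c) (Eventually.of_forall fun _ => contDiffAt_const)
  map_one' := rfl
  map_mul' _ _ := rfl
  map_zero' := rfl
  map_add' _ _ := rfl

/-- The `ℝ`-algebra (in particular `ℝ`-vector space) structure, given by the constant germs. -/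
instance : Algebra ℝ SmoothGerm := constGerm.toAlgebra

/-- The germ of the state variable `x`. -/
def xGerm : SmoothGerm := germOf Prod.fst (Eventually.of_forall fun _ => contDiffAt_fst)

/-- The germ of the distinguished parameter `l`. -/
def lGerm : SmoothGerm := germOf Prod.snd (Eventually.of_forall fun _ => contDiffAt_snd)

/-- The monomial germ `x ^ a * l ^ b` with exponent `(a, b)`. -/
def monomialGerm (e : ℕ × ℕ) : SmoothGerm := xGerm ^ e.1 * lGerm ^ e.2

/-- The ideal `⟨x, l⟩`. -/
def maxIdeal : Ideal SmoothGerm := Ideal.span {xGerm, lGerm}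

/-- A vector subspace (for instance an ideal) has finite codimension when it contains some power
of the maximal ideal. -/
def HasFiniteCodim (V : Submodule ℝ SmoothGerm) : Prop :=
  ∃ k : ℕ, ((maxIdeal ^ k : Ideal SmoothGerm) : Set SmoothGerm) ⊆ V

/-! ### Taylor coefficients, terms -/

/-- The coefficient of `x ^ a * l ^ b` in the Taylor expansion at the origin:
the partial derivative of order `(a, b)` at `(0, 0)` divided by `a! * b!`. -/
def taylorCoeffFun (e : ℕ × ℕ) (f : ℝ × ℝ → ℝ) : ℝ :=
  iteratedDeriv e.1 (fun x => iteratedDeriv e.2 (fun l => f (x, l)) 0) 0 / (e.1 ! * e.2 !)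

theorem taylorCoeffFun_congr (e : ℕ × ℕ) {f g : ℝ × ℝ → ℝ} (h : f =ᶠ[𝓝 0] g) :
    taylorCoeffFun e f = taylorCoeffFun e g := by
  have h1 : ∀ᶠ x in 𝓝 (0 : ℝ), ∀ᶠ l in 𝓝 (0 : ℝ), f (x, l) = g (x, l) := by
    have h2 : ∀ᶠ p in 𝓝 (0 : ℝ) ×ˢ 𝓝 (0 : ℝ), f p = g p := by
      rw [← nhds_prod_eq]; exact h
    exact h2.curry
  unfold taylorCoeffFun
  congr 1
  apply Filter.EventuallyEq.iteratedDeriv_eq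
  filter_upwards [h1] with x hx
  exact Filter.EventuallyEq.iteratedDeriv_eq _ hx

/-- The coefficient of the monomial with exponent `e` in the Taylor expansion of a germ. -/
def taylorCoeff (f : SmoothGerm) (e : ℕ × ℕ) : ℝ :=
  Germ.liftOn f.1 (taylorCoeffFun e) fun _ _ h => taylorCoeffFun_congr e h

/-- The nonzero terms (coefficient times monomial) of the Taylor expansion of a germ. -/
def terms (f : SmoothGerm) : Set SmoothGerm :=
  {p | ∃ e : ℕ × ℕ, taylorCoeff f e ≠ 0 ∧ p = taylorCoeff f e • monomialGerm e}

/-! ### Local orders, leading terms, standard bases -/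

/-- A local order on the monomials `x ^ a * l ^ b`, which are represented by their exponents. -/
structure LocalOrder where
  /-- the strict order `≺` -/
  lt : ℕ × ℕ → ℕ × ℕ → Prop
  strictTotal : IsStrictTotalOrder (ℕ × ℕ) lt
  add_right : ∀ a b c : ℕ × ℕ, lt a b → lt (a + c) (b + c)
  x_lt_one : lt (1, 0) (0, 0)
  l_lt_one : lt (0, 1) (0, 0)

/-- `e` is the exponent of the leading term of `f`. -/
def IsLeadingExponent (ord : LocalOrder) (f : SmoothGerm) (e : ℕ × ℕ) : Prop :=
  taylorCoeff f e ≠ 0 ∧ ∀ e', taylorCoeff f e' ≠ 0 → e' ≠ e → ord.lt e' e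

open Classical in
/-- The leading term; it is `0` for a flat germ. -/
def leadingTerm (ord : LocalOrder) (f : SmoothGerm) : SmoothGerm :=
  if h : ∃ e, IsLeadingExponent ord f e then taylorCoeff f h.choose • monomialGerm h.choose else 0

open Classical in
/-- The leading coefficient; it is `0` for a flat germ. -/
def leadingCoeff (ord : LocalOrder) (f : SmoothGerm) : ℝ :=
  if h : ∃ e, IsLeadingExponent ord f e then taylorCoeff f h.choose else 0

/-- The ideal generated by the leading terms of the elements of `I`. -/
def leadingTermIdeal (ord : LocalOrder) (I : Ideal SmoothGerm) : Ideal SmoothGerm :=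
  Ideal.span (leadingTerm ord '' (I : Set SmoothGerm))

/-- The finite set `G` generates `I`, and the leading terms of its elements generate the leading
term ideal of `I`. -/
def IsStandardBasis (ord : LocalOrder) (I : Ideal SmoothGerm) (G : Finset SmoothGerm) : Prop :=
  Ideal.span (G : Set SmoothGerm) = I ∧
    leadingTermIdeal ord I = Ideal.span (leadingTerm ord '' (G : Set SmoothGerm))

/-- A standard basis is reduced when all leading coefficients are `1` and no leading term of an
element divides a term of an element, other than itself. -/
def IsReducedStandardBasis (ord : LocalOrder) (I : Ideal SmoothGerm) (G : Finset SmoothGerm) :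
    Prop :=
  IsStandardBasis ord I G ∧ (∀ g ∈ G, leadingCoeff ord g = 1) ∧
    ∀ g ∈ G, ∀ h ∈ G, ∀ p ∈ terms h, leadingTerm ord g ∣ p → g = h ∧ p = leadingTerm ord g

/-- A reduced standard basis all of whose elements are monomial germs. -/
def IsReducedMonomialStandardBasis (ord : LocalOrder) (I : Ideal SmoothGerm)
    (G : Finset SmoothGerm) : Prop :=
  IsReducedStandardBasis ord I G ∧ ∀ g ∈ G, ∃ e, g = monomialGerm e

/-- The ideal generated by the monomial germs that lie in `I`. -/
def monomialPart (I : Ideal SmoothGerm) : Ideal SmoothGerm :=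
  Ideal.span {p | p ∈ I ∧ ∃ e, p = monomialGerm e}

/-- `I` is generated by monomial germs. -/
def IsMonomialIdeal (I : Ideal SmoothGerm) : Prop :=
  ∃ E : Set (ℕ × ℕ), I = Ideal.span (monomialGerm '' E)

/-! ### Strong equivalence, intrinsic ideals, intrinsic parts -/

/-- `g` and `h` are strongly equivalent: `g(x, l) = S(x, l) * h(X(x, l), l)` near the origin, with
`S` and `X` smooth near the origin, `S > 0`, `X(0, 0) = 0` and `∂X/∂x > 0`. -/
def StronglyEquivalent (g h : SmoothGerm) : Prop :=
  ∃ u v S X : ℝ × ℝ → ℝ,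
    (u : Germ (𝓝 (0 : ℝ × ℝ)) ℝ) = g ∧ (v : Germ (𝓝 (0 : ℝ × ℝ)) ℝ) = h ∧
    SmoothNearZero S ∧ SmoothNearZero X ∧ X 0 = 0 ∧
    (∀ᶠ p in 𝓝 (0 : ℝ × ℝ), 0 < S p ∧ 0 < deriv (fun x => X (x, p.2)) p.1) ∧
    ∀ᶠ p in 𝓝 (0 : ℝ × ℝ), u p = S p * v (X p, p.2)

/-- An ideal is intrinsic when it contains the strong equivalence class of each of its members. -/
def IsIntrinsic (I : Ideal SmoothGerm) : Prop :=
  ∀ h ∈ I, ∀ g, StronglyEquivalent g h → g ∈ I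

/-- The intrinsic part of a vector subspace: the largest intrinsic ideal contained in it. -/
def intrinsicPart (V : Submodule ℝ SmoothGerm) : Ideal SmoothGerm :=
  sSup {J : Ideal SmoothGerm | IsIntrinsic J ∧ (J : Set SmoothGerm) ⊆ V}

/-- The intrinsic part of an ideal, viewed as a vector subspace. -/
def intrinsicPartIdeal (I : Ideal SmoothGerm) : Ideal SmoothGerm :=
  intrinsicPart (I.restrictScalars ℝ)

theorem smoothNearZero_comp {v X : ℝ × ℝ → ℝ} (hv : SmoothNearZero v) (hX : SmoothNearZero X)
    (h0 : X 0 = 0) :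
    Tendsto (fun p : ℝ × ℝ => (X p, p.2)) (𝓝 0) (𝓝 0) ∧
      SmoothNearZero (fun p => v (X p, p.2)) := by
  have hc : ContinuousAt (fun p : ℝ × ℝ => (X p, p.2)) 0 :=
    (hX.self_of_nhds.continuousAt).prodMk continuousAt_snd
  have ht : Tendsto (fun p : ℝ × ℝ => (X p, p.2)) (𝓝 0) (𝓝 0) := by
    have h2 : ((X 0, (0 : ℝ × ℝ).2) : ℝ × ℝ) = 0 := by rw [h0]; rfl
    have h1 := hc.tendsto
    rwa [h2] at h1
  refine ⟨ht, ?_⟩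
  filter_upwards [ht.eventually hv, hX] with p h1 h2
  exact ContDiffAt.comp p h1 (h2.prodMk contDiffAt_snd)

theorem isIntrinsic_sSup (A : Set (Ideal SmoothGerm)) (hA : ∀ J ∈ A, IsIntrinsic J) :
    IsIntrinsic (sSup A) := by
  rintro h hh g ⟨u, v, S, X, hu, hv, hS, hX, hX0, hpos, he⟩
  have key : ∀ k ∈ sSup A, ∀ w : ℝ × ℝ → ℝ, (w : Germ (𝓝 (0 : ℝ × ℝ)) ℝ) = k →
      ∀ g' : SmoothGerm,
        ((fun p => S p * w (X p, p.2) : ℝ × ℝ → ℝ) : Germ (𝓝 (0 : ℝ × ℝ)) ℝ) = g' →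
        g' ∈ sSup A := by
    intro k hk
    rw [sSup_eq_iSup'] at hk
    induction hk using Submodule.iSup_induction' with
    | mem J k hk =>
      intro w hw g' hg'
      exact (le_sSup J.2 : J.1 ≤ sSup A) (hA J.1 J.2 k hk g'
        ⟨_, w, S, X, hg', hw, hS, hX, hX0, hpos, Eventually.of_forall fun _ => rfl⟩)
    | zero =>
      intro w hw g' hg'
      have hw0 : ∀ᶠ p in 𝓝 (0 : ℝ × ℝ), w p = 0 := Germ.coe_eq.1 hw
      have hS0 : SmoothNearZero (0 : ℝ × ℝ → ℝ) := Eventually.of_forall fun _ => contDiffAt_const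
      have ht := (smoothNearZero_comp hS0 hX hX0).1
      have : g' = 0 := by
        apply Subtype.ext
        rw [← hg']
        apply Germ.coe_eq.2
        filter_upwards [ht.eventually hw0] with p hp
        simp [hp]
      rw [this]; exact Submodule.zero_mem _
    | add k₁ k₂ h1 h2 ih1 ih2 =>
      intro w hw g' hg'
      obtain ⟨w₁, hs1, hw1⟩ := k₁.2
      obtain ⟨w₂, hs2, hw2⟩ := k₂.2
      have ht := (smoothNearZero_comp hs1 hX hX0).1
      have hm : ∀ w', SmoothNearZero w' → SmoothNearZero (fun p => S p * w' (X p, p.2)) := by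
        intro w' hw'
        filter_upwards [hS, (smoothNearZero_comp hw' hX hX0).2] with p a b using a.mul b
      have i1 := ih1 w₁ hw1 (germOf _ (hm w₁ hs1)) rfl
      have i2 := ih2 w₂ hw2 (germOf _ (hm w₂ hs2)) rfl
      have hww : ∀ᶠ p in 𝓝 (0 : ℝ × ℝ), w p = w₁ p + w₂ p := by
        apply Germ.coe_eq.1
        rw [hw]
        change k₁.1 + k₂.1 = _
        rw [← hw1, ← hw2]
        rfl
      have : g' = germOf _ (hm w₁ hs1) + germOf _ (hm w₂ hs2) := by
        apply Subtype.ext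
        rw [← hg']
        apply Germ.coe_eq.2
        filter_upwards [ht.eventually hww] with p hp
        simp [hp, mul_add]
      rw [this]
      exact Submodule.add_mem _ i1 i2
  refine key h hh v hv g ?_
  rw [← hu]
  exact (Germ.coe_eq.2 he).symm

/-- The intrinsic part is the largest intrinsic ideal contained in the subspace. -/
theorem intrinsicPart_isGreatest (V : Submodule ℝ SmoothGerm) :
    IsGreatest {J : Ideal SmoothGerm | IsIntrinsic J ∧ (J : Set SmoothGerm) ⊆ V}
      (intrinsicPart V) := by
  refine ⟨⟨isIntrinsic_sSup _ fun J hJ => hJ.1, ?_⟩, fun J hJ => le_sSup hJ⟩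
  intro k hk
  have hk' : k ∈ sSup {J : Ideal SmoothGerm | IsIntrinsic J ∧ (J : Set SmoothGerm) ⊆ V} := hk
  rw [sSup_eq_iSup'] at hk'
  change k ∈ V
  induction hk' using Submodule.iSup_induction' with
  | mem J k hkJ => exact J.2.2 hkJ
  | zero => exact V.zero_mem
  | add k₁ k₂ h1 h2 ih1 ih2 =>
    refine V.add_mem (ih1 ?_) (ih2 ?_) <;> (unfold intrinsicPart; rwa [sSup_eq_iSup'])

/-- `I = ∑ i, 𝓜 ^ m i * ⟨l ^ n i⟩`, where `n i` is strictly increasing and `m i + n i` is strictly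
decreasing. Such an ideal has finite codimension exactly when the first `n i` exists and is `0`;
the empty sum is the zero ideal. -/
def IsIntrinsicPresentation (I : Ideal SmoothGerm) (s : ℕ) (m n : Fin s → ℕ) : Prop :=
  StrictMono n ∧ StrictAnti (fun i => m i + n i) ∧
    I = ⨆ i, maxIdeal ^ m i * Ideal.span {lGerm ^ n i}

/-- The intrinsic generators `x ^ m i * l ^ n i` of `I`. -/
def intrinsicGenerators (I : Ideal SmoothGerm) : Set SmoothGerm :=
  {p | ∃ (s : ℕ) (m n : Fin s → ℕ), IsIntrinsicPresentation I s m n ∧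
    ∃ i, p = monomialGerm (m i, n i)}

end SingularityGerms

end

noncomputable section

namespace SingularityGerms

/-! ### Smoothness of parametric integrals and Hadamard's lemma -/

/-! Two one-parameter families of substitutions control the monomials of an intrinsic ideal `I`.
Putting `c x` for `x`, with `c > 0`, multiplies `x ^ a * p(λ)` by `c ^ a`, so a Vandermonde
inversion splits an element of `I` that is polynomial in `x` into its pieces `x ^ a * p(λ)`. Each
nonzero `p(λ)` is a power of `λ` times a unit, so a monomial of `I` divides the piece. Modulo a
power of the maximal ideal every germ is a polynomial; hence an intrinsic ideal of finite
codimension is generated by monomials (`IsIntrinsic.monomialPart_eq_self`).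

Putting `x + c λ` for `x` and reading off the coefficient of `c` turns `x ^ (a + 1) * λ ^ b` into `x
^ a * λ ^ (b + 1)`. So the exponents of `I` are closed upwards for the comparison of `b` and of `a +
b` (`IsIntrinsic.monomialGerm_mem`). In the coordinates `(b, a + b)` they fill a staircase with
finitely many corners, and these corners are the intrinsic presentation.

Membership of a monomial in a monomial ideal is read from Taylor coefficients, so the monomials with
minimal exponent form a reduced standard basis for every local order.

For the decompositions, an intrinsic ideal `J` with any monomial also contains a power of `λ`.
Hadamard's lemma, applied to one power of `λ` after another, then removes from any germ all terms
with exponents in `J`, at the cost of an element of `J` (`IsIntrinsic.exists_sub_mem`). Applied with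
the intrinsic part as `J` to a finite set of generators, this leaves the sum unchanged. It requires
no finite codimension, so it covers every finitely generated ideal. -/

theorem hasFDerivAt_intervalIntegral_of_contDiff {H E : Type} [NormedAddCommGroup H]
    [NormedSpace ℝ H] [ProperSpace H] [NormedAddCommGroup E] [NormedSpace ℝ E]
    {G : H × ℝ → E} (hG : ContDiff ℝ 1 G) (p : H) :
    HasFDerivAt (fun p => ∫ t in (0 : ℝ)..1, G (p, t))
      (∫ t in (0 : ℝ)..1, (fderiv ℝ G (p, t)).comp (ContinuousLinearMap.inl ℝ H ℝ)) p := by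
  have hc : Continuous fun q : H × ℝ =>
      (fderiv ℝ G q).comp (ContinuousLinearMap.inl ℝ H ℝ) :=
    (hG.continuous_fderiv one_ne_zero).clm_comp continuous_const
  obtain ⟨C, hC⟩ := ((isCompact_closedBall p 1).prod (isCompact_Icc (a := (0 : ℝ)) (b := 1))
    ).exists_bound_of_continuousOn hc.continuousOn
  refine intervalIntegral.hasFDerivAt_integral_of_dominated_of_fderiv_le
    (F := fun p t => G (p, t))
    (F' := fun p t => (fderiv ℝ G (p, t)).comp (ContinuousLinearMap.inl ℝ H ℝ))
    (bound := fun _ => C) (Metric.closedBall_mem_nhds p one_pos) ?_ ?_ ?_ ?_ ?_ ?_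
  · exact Eventually.of_forall fun q =>
      (hG.continuous.comp (Continuous.prodMk_right q)).aestronglyMeasurable
  · exact (hG.continuous.comp (Continuous.prodMk_right p)).intervalIntegrable _ _
  · exact (hc.comp (Continuous.prodMk_right p)).aestronglyMeasurable
  · refine Eventually.of_forall fun t ht q hq => hC (q, t) ⟨hq, ?_⟩
    rw [Set.uIoc_of_le zero_le_one] at ht
    exact ⟨ht.1.le, ht.2⟩
  · exact intervalIntegrable_const
  · refine Eventually.of_forall fun t _ q _ => ?_
    have h1 := ((hG.differentiable one_ne_zero) (q, t)).hasFDerivAt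
    exact h1.comp q (hasFDerivAt_prodMk_left q t)

/-- The derivative of a parametric integral is a parametric integral with values in a space of
linear maps; the target `E` therefore varies in the induction on `n`. -/
theorem contDiff_nat_intervalIntegral {H : Type} [NormedAddCommGroup H] [NormedSpace ℝ H]
    [ProperSpace H] (n : ℕ) : ∀ {E : Type} [NormedAddCommGroup E] [NormedSpace ℝ E]
    {G : H × ℝ → E}, ContDiff ℝ ∞ G →
    ContDiff ℝ n (fun p => ∫ t in (0 : ℝ)..1, G (p, t)) := by
  induction n with
  | zero =>
    intro E _ _ G hG
    have hd p := hasFDerivAt_intervalIntegral_of_contDiff (hG.of_le (by simp)) p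
    exact contDiff_zero.2 (continuous_iff_continuousAt.2 fun p => (hd p).continuousAt)
  | succ n ih =>
    intro E _ _ G hG
    have hd p := hasFDerivAt_intervalIntegral_of_contDiff (hG.of_le (by simp)) p
    push_cast
    rw [contDiff_succ_iff_fderiv]
    refine ⟨fun p => (hd p).differentiableAt, by simp, ?_⟩
    have h1 : fderiv ℝ (fun p => ∫ t in (0 : ℝ)..1, G (p, t)) = fun p =>
        ∫ t in (0 : ℝ)..1, (fderiv ℝ G (p, t)).comp (ContinuousLinearMap.inl ℝ H ℝ) :=
      funext fun p => (hd p).fderiv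
    rw [h1]
    exact ih (G := fun q => (fderiv ℝ G q).comp (ContinuousLinearMap.inl ℝ H ℝ))
      ((hG.fderiv_right (by simp)).clm_comp contDiff_const)

theorem contDiff_intervalIntegral {H E : Type} [NormedAddCommGroup H] [NormedSpace ℝ H]
    [ProperSpace H] [NormedAddCommGroup E] [NormedSpace ℝ E] {G : H × ℝ → E}
    (hG : ContDiff ℝ ∞ G) : ContDiff ℝ ∞ (fun p => ∫ t in (0 : ℝ)..1, G (p, t)) :=
  contDiff_infty.2 fun n => contDiff_nat_intervalIntegral n hG

/-- Cutting off by a bump function supported where `f` is smooth gives a global representative, so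
integrals along segments need no domain conditions. -/
theorem SmoothNearZero.exists_contDiff {f : ℝ × ℝ → ℝ} (hf : SmoothNearZero f) :
    ∃ g : ℝ × ℝ → ℝ, ContDiff ℝ ∞ g ∧ g =ᶠ[𝓝 0] f := by
  obtain ⟨ε, hε, h⟩ := Metric.eventually_nhds_iff_ball.1 hf
  let χ : ContDiffBump (0 : ℝ × ℝ) := ⟨ε / 3, ε / 2, by positivity, by linarith⟩
  refine ⟨fun p => χ p * f p, contDiff_iff_contDiffAt.2 fun p => ?_, ?_⟩
  · by_cases hp : p ∈ tsupport fun p => χ p * f p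
    swap
    · exact contDiffAt_const.congr_of_eventuallyEq (notMem_tsupport_iff_eventuallyEq.1 hp)
    have h1 : p ∈ tsupport χ := tsupport_mul_subset_left hp
    rw [χ.tsupport_eq] at h1
    exact χ.contDiffAt.mul (h p (Metric.closedBall_subset_ball (half_lt_self hε) h1))
  · filter_upwards [χ.eventuallyEq_one] with p hp
    simp [hp]

/-- **Hadamard's lemma** in the second variable, for functions smooth everywhere. -/
theorem exists_hadamard_of_contDiff {f : ℝ × ℝ → ℝ} (hf : ContDiff ℝ ∞ f) :
    ∃ q : ℝ × ℝ → ℝ, ContDiff ℝ ∞ q ∧ ∀ p, f p = f (p.1, 0) + p.2 * q p := by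
  -- The quotient is `q(x, λ) = ∫₀¹ ∂f/∂λ (x, tλ) dt`; this is its integrand.
  have hG : ContDiff ℝ ∞ fun z : (ℝ × ℝ) × ℝ => fderiv ℝ f (z.1.1, z.2 * z.1.2) (0, 1) :=
    ((hf.fderiv_right (m := ∞) (by simp)).comp (by fun_prop)).clm_apply contDiff_const
  refine ⟨_, contDiff_intervalIntegral hG, fun p => ?_⟩
  have hd : ∀ t ∈ Set.uIcc (0 : ℝ) 1, HasDerivAt (fun t : ℝ => f (p.1, t * p.2))
      (p.2 * fderiv ℝ f (p.1, t * p.2) (0, 1)) t := by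
    intro t _
    have h1 : HasDerivAt (fun t : ℝ => (p.1, t * p.2)) (0, p.2) t := by
      have := (hasDerivAt_id t).mul_const p.2
      simp only [one_mul] at this
      exact (hasDerivAt_const t p.1).prodMk this
    have h2 := ((hf.differentiable (by simp)) (p.1, t * p.2)).hasFDerivAt.comp_hasDerivAt t h1
    have h3 : ((0, p.2) : ℝ × ℝ) = p.2 • (0, 1) := by simp
    rwa [h3, map_smul, smul_eq_mul] at h2
  have hi := intervalIntegral.integral_eq_sub_of_hasDerivAt hd (Continuous.intervalIntegrable
    (continuous_const.mul (hG.continuous.comp (Continuous.prodMk_right p))) _ _)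
  rw [intervalIntegral.integral_const_mul] at hi
  simp only [one_mul, zero_mul] at hi
  rw [hi]
  ring

theorem tendsto_fst_zero : Tendsto (fun p : ℝ × ℝ => (p.1, (0 : ℝ))) (𝓝 0) (𝓝 0) :=
  Continuous.tendsto' (by fun_prop) _ _ rfl

theorem tendsto_swap_zero : Tendsto (Prod.swap : ℝ × ℝ → ℝ × ℝ) (𝓝 0) (𝓝 0) :=
  Continuous.tendsto' (by fun_prop) _ _ rfl

/-- **Hadamard's lemma** in the second variable, near the origin. -/
theorem SmoothNearZero.exists_hadamard_snd {f : ℝ × ℝ → ℝ} (hf : SmoothNearZero f) :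
    ∃ q : ℝ × ℝ → ℝ, SmoothNearZero q ∧ ∀ᶠ p in 𝓝 0, f p = f (p.1, 0) + p.2 * q p := by
  obtain ⟨g, hg, hgf⟩ := hf.exists_contDiff
  obtain ⟨q, hq, h⟩ := exists_hadamard_of_contDiff hg
  refine ⟨q, Eventually.of_forall fun p => hq.contDiffAt, ?_⟩
  filter_upwards [hgf, tendsto_fst_zero.eventually hgf] with p h1 h2
  rw [← h1, ← h2, h p]

/-- **Hadamard's lemma** in the first variable, near the origin. -/
theorem SmoothNearZero.exists_hadamard_fst {f : ℝ × ℝ → ℝ} (hf : SmoothNearZero f) :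
    ∃ q : ℝ × ℝ → ℝ, SmoothNearZero q ∧ ∀ᶠ p in 𝓝 0, f p = f (0, p.2) + p.1 * q p := by
  have hs : ∀ {u : ℝ × ℝ → ℝ}, SmoothNearZero u → SmoothNearZero (u ∘ Prod.swap) := by
    intro u hu
    filter_upwards [tendsto_swap_zero.eventually hu] with p hp
    exact hp.comp p (contDiffAt_snd.prodMk contDiffAt_fst)
  obtain ⟨q, hq, h⟩ := (hs hf).exists_hadamard_snd
  refine ⟨q ∘ Prod.swap, hs hq, ?_⟩
  filter_upwards [tendsto_swap_zero.eventually h] with p hp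
  simpa using hp

/-! ### Germs, evaluation, partial derivatives -/

theorem exists_germOf_eq (g : SmoothGerm) : ∃ f hf, germOf f hf = g := by
  obtain ⟨_, f, hf, rfl⟩ := g
  exact ⟨f, hf, rfl⟩

theorem germOf_eq_iff {f g : ℝ × ℝ → ℝ} {hf : SmoothNearZero f} {hg : SmoothNearZero g} :
    germOf f hf = germOf g hg ↔ f =ᶠ[𝓝 0] g :=
  Subtype.ext_iff.trans Germ.coe_eq

theorem germ_eq_of_eventuallyEq {a b : SmoothGerm} {f g : ℝ × ℝ → ℝ} (h : f =ᶠ[𝓝 0] g)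
    (ha : (f : Germ (𝓝 (0 : ℝ × ℝ)) ℝ) = a.1) (hb : (g : Germ (𝓝 (0 : ℝ × ℝ)) ℝ) = b.1) : a = b :=
  Subtype.ext (ha.symm.trans ((Germ.coe_eq.2 h).trans hb))

/-- The value of a germ at the origin. -/
def evalZero : SmoothGerm →+* ℝ :=
  (Germ.valueRingHom (x := (0 : ℝ × ℝ))).comp smoothGermSubring.subtype

theorem evalZero_germOf {f : ℝ × ℝ → ℝ} (hf : SmoothNearZero f) :
    evalZero (germOf f hf) = f 0 := rfl

theorem smul_eq_constGerm_mul (c : ℝ) (f : SmoothGerm) : c • f = constGerm c * f :=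
  Algebra.smul_def c f

theorem evalZero_constGerm (c : ℝ) : evalZero (constGerm c) = c := rfl

theorem evalZero_smul (c : ℝ) (f : SmoothGerm) : evalZero (c • f) = c * evalZero f := by
  rw [smul_eq_constGerm_mul, map_mul, evalZero_constGerm]

theorem evalZero_xGerm : evalZero xGerm = 0 := rfl

theorem evalZero_lGerm : evalZero lGerm = 0 := rfl

theorem isUnit_of_evalZero_ne_zero {f : SmoothGerm} (h : evalZero f ≠ 0) : IsUnit f := by
  obtain ⟨u, hu, rfl⟩ := exists_germOf_eq f
  have h0 : ∀ᶠ p in 𝓝 0, u p ≠ 0 := hu.self_of_nhds.continuousAt.eventually_ne h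
  refine IsUnit.of_mul_eq_one (germOf (fun p => (u p)⁻¹) ?_)
    (germ_eq_of_eventuallyEq (f := fun p => u p * (u p)⁻¹) (g := fun _ => 1) ?_ rfl rfl)
  · filter_upwards [hu, h0] with p h1 h2 using h1.inv h2
  · filter_upwards [h0] with p hp using mul_inv_cancel₀ hp

/-- The partial derivative of a function in the first variable. -/
def derivFst (f : ℝ × ℝ → ℝ) (p : ℝ × ℝ) : ℝ := deriv (fun x => f (x, p.2)) p.1

/-- The partial derivative of a function in the second variable. -/
def derivSnd (f : ℝ × ℝ → ℝ) (p : ℝ × ℝ) : ℝ := deriv (fun l => f (p.1, l)) p.2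

theorem hasDerivAt_fst {f : ℝ × ℝ → ℝ} {p : ℝ × ℝ} (hf : ContDiffAt ℝ ∞ f p) :
    HasDerivAt (fun x => f (x, p.2)) (fderiv ℝ f p (1, 0)) p.1 :=
  (hf.differentiableAt (by simp)).hasFDerivAt.comp_hasDerivAt (f := fun x => (x, p.2)) p.1
    ((hasDerivAt_id p.1).prodMk (hasDerivAt_const p.1 p.2))

theorem hasDerivAt_snd {f : ℝ × ℝ → ℝ} {p : ℝ × ℝ} (hf : ContDiffAt ℝ ∞ f p) :
    HasDerivAt (fun l => f (p.1, l)) (fderiv ℝ f p (0, 1)) p.2 :=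
  (hf.differentiableAt (by simp)).hasFDerivAt.comp_hasDerivAt (f := fun l => (p.1, l)) p.2
    ((hasDerivAt_const p.2 p.1).prodMk (hasDerivAt_id p.2))

theorem SmoothNearZero.fderiv_apply {f : ℝ × ℝ → ℝ} (hf : SmoothNearZero f) (v : ℝ × ℝ) :
    SmoothNearZero (fun p => fderiv ℝ f p v) := by
  filter_upwards [hf] with p hp
  exact (hp.fderiv_right (m := ∞) (by simp)).clm_apply contDiffAt_const

theorem SmoothNearZero.congr {f g : ℝ × ℝ → ℝ} (hf : SmoothNearZero f) (h : g =ᶠ[𝓝 0] f) :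
    SmoothNearZero g := by
  filter_upwards [hf, h.eventually_nhds] with p h1 h2 using h1.congr_of_eventuallyEq h2

theorem SmoothNearZero.derivFst {f : ℝ × ℝ → ℝ} (hf : SmoothNearZero f) :
    SmoothNearZero (derivFst f) :=
  (hf.fderiv_apply (1, 0)).congr (hf.mono fun _ hp => (hasDerivAt_fst hp).deriv)

theorem SmoothNearZero.derivSnd {f : ℝ × ℝ → ℝ} (hf : SmoothNearZero f) :
    SmoothNearZero (derivSnd f) :=
  (hf.fderiv_apply (0, 1)).congr (hf.mono fun _ hp => (hasDerivAt_snd hp).deriv)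

theorem derivFst_congr {f g : ℝ × ℝ → ℝ} (h : f =ᶠ[𝓝 0] g) : derivFst f =ᶠ[𝓝 0] derivFst g := by
  filter_upwards [h.eventually_nhds] with p hp
  exact Filter.EventuallyEq.deriv_eq
    ((Continuous.tendsto' (by fun_prop) p.1 p rfl : Tendsto (fun x => (x, p.2)) _ _).eventually hp)

theorem derivSnd_congr {f g : ℝ × ℝ → ℝ} (h : f =ᶠ[𝓝 0] g) : derivSnd f =ᶠ[𝓝 0] derivSnd g := by
  filter_upwards [h.eventually_nhds] with p hp
  exact Filter.EventuallyEq.deriv_eq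
    ((Continuous.tendsto' (by fun_prop) p.2 p rfl : Tendsto (fun l => (p.1, l)) _ _).eventually hp)

/-- A derivation of the ring of germs from an operator on functions which is local, preserves
smoothness, and satisfies the rules of differentiation. -/
def derivationOfLocal (D : (ℝ × ℝ → ℝ) → ℝ × ℝ → ℝ)
    (hs : ∀ {f}, SmoothNearZero f → SmoothNearZero (D f))
    (hc : ∀ {f g}, f =ᶠ[𝓝 0] g → D f =ᶠ[𝓝 0] D g)
    (hadd : ∀ {f g}, SmoothNearZero f → SmoothNearZero g → D (f + g) =ᶠ[𝓝 0] D f + D g)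
    (hsmul : ∀ (c : ℝ) {f}, SmoothNearZero f → D (fun p => c * f p) =ᶠ[𝓝 0] fun p => c * D f p)
    (hmul : ∀ {f g}, SmoothNearZero f → SmoothNearZero g → D (f * g) =ᶠ[𝓝 0] f * D g + g * D f) :
    Derivation ℝ SmoothGerm SmoothGerm :=
  -- `T` uses a chosen representative; locality of `D` makes the choice irrelevant, which is `hT`.
  let T : SmoothGerm → SmoothGerm := fun g => germOf (D g.2.choose) (hs g.2.choose_spec.1)
  have hT : ∀ f hf, T (germOf f hf) = germOf (D f) (hs hf) := fun f hf =>
    germOf_eq_iff.2 (hc (Germ.coe_eq.1 (germOf f hf).2.choose_spec.2))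
  Derivation.mk'
    { toFun := T
      map_add' := fun a b => by
        obtain ⟨f, hf, rfl⟩ := exists_germOf_eq a
        obtain ⟨g, hg, rfl⟩ := exists_germOf_eq b
        have hfg : SmoothNearZero (f + g) := by
          filter_upwards [hf, hg] with p h1 h2 using h1.add h2
        rw [hT, hT]
        exact (hT (f + g) hfg).trans
          (germ_eq_of_eventuallyEq (hadd hf hg) rfl rfl)
      map_smul' := fun c a => by
        obtain ⟨f, hf, rfl⟩ := exists_germOf_eq a
        have hcf : SmoothNearZero (fun p => c * f p) := by
          filter_upwards [hf] with p h1 using contDiffAt_const.mul h1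
        rw [hT]
        exact (hT (fun p => c * f p) hcf).trans
          (germ_eq_of_eventuallyEq (hsmul c hf) rfl rfl) }
    fun a b => by
      obtain ⟨f, hf, rfl⟩ := exists_germOf_eq a
      obtain ⟨g, hg, rfl⟩ := exists_germOf_eq b
      have hfg : SmoothNearZero (f * g) := by
        filter_upwards [hf, hg] with p h1 h2 using h1.mul h2
      change T _ = _ * T _ + _ * T _
      rw [hT, hT]
      exact (hT (f * g) hfg).trans
          (germ_eq_of_eventuallyEq (hmul hf hg) rfl rfl)

theorem derivationOfLocal_germOf {D hs hc hadd hsmul hmul} {f : ℝ × ℝ → ℝ}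
    (hf : SmoothNearZero f) :
    derivationOfLocal D hs hc hadd hsmul hmul (germOf f hf) = germOf (D f) (hs hf) :=
  germ_eq_of_eventuallyEq (hc (Germ.coe_eq.1 (germOf f hf).2.choose_spec.2)) rfl rfl

/-- The derivation `∂/∂x` of the ring of germs. -/
def Dx : Derivation ℝ SmoothGerm SmoothGerm :=
  derivationOfLocal derivFst (fun h => h.derivFst) derivFst_congr
    (fun {f g} hf hg => by
      filter_upwards [hf, hg] with p h1 h2
      have h := ((hasDerivAt_fst h1).add (hasDerivAt_fst h2)).deriv
      change deriv (fun x => f (x, p.2) + g (x, p.2)) p.1 = _ at h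
      simp only [derivFst, Pi.add_apply, (hasDerivAt_fst h1).deriv, (hasDerivAt_fst h2).deriv, h])
    (fun c _ hf => by
      filter_upwards [hf] with p h1
      simp [derivFst])
    (fun {f g} hf hg => by
      filter_upwards [hf, hg] with p h1 h2
      have h := ((hasDerivAt_fst h1).mul (hasDerivAt_fst h2)).deriv
      change deriv (fun x => f (x, p.2) * g (x, p.2)) p.1 = _ at h
      simp only [derivFst, Pi.mul_apply, Pi.add_apply, (hasDerivAt_fst h1).deriv,
        (hasDerivAt_fst h2).deriv, h]
      ring)

/-- The derivation `∂/∂l` of the ring of germs. -/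
def Dl : Derivation ℝ SmoothGerm SmoothGerm :=
  derivationOfLocal derivSnd (fun h => h.derivSnd) derivSnd_congr
    (fun {f g} hf hg => by
      filter_upwards [hf, hg] with p h1 h2
      have h := ((hasDerivAt_snd h1).add (hasDerivAt_snd h2)).deriv
      change deriv (fun l => f (p.1, l) + g (p.1, l)) p.2 = _ at h
      simp only [derivSnd, Pi.add_apply, (hasDerivAt_snd h1).deriv, (hasDerivAt_snd h2).deriv, h])
    (fun c _ hf => by
      filter_upwards [hf] with p h1
      simp [derivSnd])
    (fun {f g} hf hg => by
      filter_upwards [hf, hg] with p h1 h2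
      have h := ((hasDerivAt_snd h1).mul (hasDerivAt_snd h2)).deriv
      change deriv (fun l => f (p.1, l) * g (p.1, l)) p.2 = _ at h
      simp only [derivSnd, Pi.mul_apply, Pi.add_apply, (hasDerivAt_snd h1).deriv,
        (hasDerivAt_snd h2).deriv, h]
      ring)

theorem Dx_germOf {f : ℝ × ℝ → ℝ} (hf : SmoothNearZero f) :
    Dx (germOf f hf) = germOf (derivFst f) hf.derivFst := derivationOfLocal_germOf hf

theorem Dl_germOf {f : ℝ × ℝ → ℝ} (hf : SmoothNearZero f) :
    Dl (germOf f hf) = germOf (derivSnd f) hf.derivSnd := derivationOfLocal_germOf hf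

theorem Dx_xGerm : Dx xGerm = 1 :=
  (Dx_germOf _).trans (germOf_eq_iff.2 (Eventually.of_forall fun p => by simp [derivFst]) :
    _ = germOf (fun _ => 1) (Eventually.of_forall fun _ => contDiffAt_const))

theorem Dx_lGerm : Dx lGerm = 0 :=
  (Dx_germOf _).trans (germOf_eq_iff.2 (Eventually.of_forall fun p => by simp [derivFst]) :
    _ = germOf (fun _ => 0) (Eventually.of_forall fun _ => contDiffAt_const))

theorem Dl_xGerm : Dl xGerm = 0 :=
  (Dl_germOf _).trans (germOf_eq_iff.2 (Eventually.of_forall fun p => by simp [derivSnd]) :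
    _ = germOf (fun _ => 0) (Eventually.of_forall fun _ => contDiffAt_const))

theorem Dl_lGerm : Dl lGerm = 1 :=
  (Dl_germOf _).trans (germOf_eq_iff.2 (Eventually.of_forall fun p => by simp [derivSnd]) :
    _ = germOf (fun _ => 1) (Eventually.of_forall fun _ => contDiffAt_const))

theorem SmoothNearZero.iterate_derivFst {f : ℝ × ℝ → ℝ} (hf : SmoothNearZero f) (n : ℕ) :
    SmoothNearZero (SingularityGerms.derivFst^[n] f) := by
  induction n with
  | zero => exact hf
  | succ n ih => rw [Function.iterate_succ_apply']; exact ih.derivFst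

theorem SmoothNearZero.iterate_derivSnd {f : ℝ × ℝ → ℝ} (hf : SmoothNearZero f) (n : ℕ) :
    SmoothNearZero (SingularityGerms.derivSnd^[n] f) := by
  induction n with
  | zero => exact hf
  | succ n ih => rw [Function.iterate_succ_apply']; exact ih.derivSnd

theorem Dx_iterate_germOf {f : ℝ × ℝ → ℝ} (hf : SmoothNearZero f) (n : ℕ) :
    Dx^[n] (germOf f hf) = germOf (derivFst^[n] f) (hf.iterate_derivFst n) := by
  induction n with
  | zero => rfl
  | succ n ih =>
    rw [Function.iterate_succ_apply', ih, Dx_germOf]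
    exact germOf_eq_iff.2 (by rw [Function.iterate_succ_apply'])

theorem Dl_iterate_germOf {f : ℝ × ℝ → ℝ} (hf : SmoothNearZero f) (n : ℕ) :
    Dl^[n] (germOf f hf) = germOf (derivSnd^[n] f) (hf.iterate_derivSnd n) := by
  induction n with
  | zero => rfl
  | succ n ih =>
    rw [Function.iterate_succ_apply', ih, Dl_germOf]
    exact germOf_eq_iff.2 (by rw [Function.iterate_succ_apply'])

theorem iterate_derivFst_eq (n : ℕ) (f : ℝ × ℝ → ℝ) (p : ℝ × ℝ) :
    derivFst^[n] f p = iteratedDeriv n (fun x => f (x, p.2)) p.1 := by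
  induction n generalizing f with
  | zero => simp
  | succ n ih => rw [Function.iterate_succ_apply, ih, iteratedDeriv_succ']; rfl

theorem iterate_derivSnd_eq (n : ℕ) (f : ℝ × ℝ → ℝ) (p : ℝ × ℝ) :
    derivSnd^[n] f p = iteratedDeriv n (fun l => f (p.1, l)) p.2 := by
  induction n generalizing f with
  | zero => simp
  | succ n ih => rw [Function.iterate_succ_apply, ih, iteratedDeriv_succ']; rfl

/-! ### Taylor coefficients -/

/-- With derivations in place of iterated derivatives of functions, products are handled by the
Leibniz rule alone. -/
theorem taylorCoeff_eq (f : SmoothGerm) (e : ℕ × ℕ) :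
    taylorCoeff f e = evalZero (Dx^[e.1] (Dl^[e.2] f)) / (e.1 ! * e.2 !) := by
  obtain ⟨u, hu, rfl⟩ := exists_germOf_eq f
  rw [Dl_iterate_germOf, Dx_iterate_germOf, evalZero_germOf, iterate_derivFst_eq]
  simp only [iterate_derivSnd_eq]
  rfl

theorem taylorCoeff_zero_exponent (f : SmoothGerm) : taylorCoeff f (0, 0) = evalZero f := by
  simp [taylorCoeff_eq]

theorem taylorCoeff_add (f g : SmoothGerm) (e : ℕ × ℕ) :
    taylorCoeff (f + g) e = taylorCoeff f e + taylorCoeff g e := by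
  simp only [taylorCoeff_eq, iterate_map_add, map_add, add_div]

theorem taylorCoeff_zero (e : ℕ × ℕ) : taylorCoeff 0 e = 0 := by
  simp only [taylorCoeff_eq, iterate_map_zero, map_zero, zero_div]

theorem taylorCoeff_smul (c : ℝ) (f : SmoothGerm) (e : ℕ × ℕ) :
    taylorCoeff (c • f) e = c * taylorCoeff f e := by
  have h : ∀ (D : Derivation ℝ SmoothGerm SmoothGerm) (n : ℕ) (g : SmoothGerm),
      D^[n] (c • g) = c • D^[n] g := fun D n g =>
    (Function.Semiconj.iterate_right (f := fun g : SmoothGerm => c • g)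
      (fun g => (D.map_smul c g).symm) n g).symm
  rw [taylorCoeff_eq, taylorCoeff_eq, h, h, evalZero_smul, mul_div_assoc]

theorem iterate_mul_of_apply_eq_zero (D : Derivation ℝ SmoothGerm SmoothGerm) {z : SmoothGerm}
    (hz : D z = 0) (f : SmoothGerm) (n : ℕ) : D^[n] (z * f) = z * D^[n] f := by
  induction n with
  | zero => rfl
  | succ n ih =>
    rw [Function.iterate_succ_apply', Function.iterate_succ_apply', ih, D.leibniz, hz]
    simp

/-- Since `D z = 1`, the higher derivatives of `z` vanish and the Leibniz formula keeps two terms.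
At the origin only the second survives, and its factor `n + 1` cancels against the factorial. -/
theorem iterate_mul_of_apply_eq_one (D : Derivation ℝ SmoothGerm SmoothGerm) {z : SmoothGerm}
    (hz : D z = 1) (f : SmoothGerm) (n : ℕ) :
    D^[n + 1] (z * f) = z * D^[n + 1] f + ((n + 1 : ℕ) : SmoothGerm) * D^[n] f := by
  induction n with
  | zero => simp [D.leibniz, hz]
  | succ n ih =>
    have h0 : D ((n + 1 : ℕ) : SmoothGerm) = 0 := D.map_natCast _
    rw [Function.iterate_succ_apply', ih, map_add, D.leibniz, D.leibniz, hz, h0,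
      Function.iterate_succ_apply' D (n + 1) f, Function.iterate_succ_apply' D n f]
    simp only [smul_eq_mul]
    push_cast
    ring

theorem taylorCoeff_xGerm_mul_succ (f : SmoothGerm) (a b : ℕ) :
    taylorCoeff (xGerm * f) (a + 1, b) = taylorCoeff f (a, b) := by
  simp only [taylorCoeff_eq, iterate_mul_of_apply_eq_zero Dl Dl_xGerm,
    iterate_mul_of_apply_eq_one Dx Dx_xGerm, map_add, map_mul, evalZero_xGerm, zero_mul, zero_add,
    map_natCast, Nat.factorial_succ, Nat.cast_mul]
  rw [mul_assoc, mul_div_mul_left _ _ (by positivity)]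

theorem taylorCoeff_xGerm_mul_zero (f : SmoothGerm) (b : ℕ) :
    taylorCoeff (xGerm * f) (0, b) = 0 := by
  simp [taylorCoeff_eq, iterate_mul_of_apply_eq_zero Dl Dl_xGerm, evalZero_xGerm]

theorem taylorCoeff_lGerm_mul_succ (f : SmoothGerm) (a b : ℕ) :
    taylorCoeff (lGerm * f) (a, b + 1) = taylorCoeff f (a, b) := by
  have h0 : Dx ((b + 1 : ℕ) : SmoothGerm) = 0 := Dx.map_natCast _
  simp only [taylorCoeff_eq, iterate_mul_of_apply_eq_one Dl Dl_lGerm, iterate_map_add,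
    iterate_mul_of_apply_eq_zero Dx Dx_lGerm, iterate_mul_of_apply_eq_zero Dx h0, map_add, map_mul,
    evalZero_lGerm, zero_mul, zero_add, map_natCast, Nat.factorial_succ, Nat.cast_mul]
  rw [mul_left_comm, mul_div_mul_left _ _ (by positivity)]

theorem taylorCoeff_lGerm_mul_zero (f : SmoothGerm) (a : ℕ) :
    taylorCoeff (lGerm * f) (a, 0) = 0 := by
  simp [taylorCoeff_eq, iterate_mul_of_apply_eq_zero Dx Dx_lGerm, evalZero_lGerm]

theorem monomialGerm_zero : monomialGerm (0, 0) = 1 := by simp [monomialGerm]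

theorem monomialGerm_add (e e' : ℕ × ℕ) :
    monomialGerm (e + e') = monomialGerm e * monomialGerm e' := by
  simp only [monomialGerm, Prod.fst_add, Prod.snd_add, pow_add]
  ring

theorem taylorCoeff_monomialGerm_mul (e : ℕ × ℕ) (f : SmoothGerm) (e' : ℕ × ℕ) :
    taylorCoeff (monomialGerm e * f) e' = if e ≤ e' then taylorCoeff f (e' - e) else 0 := by
  obtain ⟨a, b⟩ := e
  induction a generalizing e' with
  | zero =>
    induction b generalizing e' with
    | zero => rw [monomialGerm_zero, one_mul, if_pos (show ((0, 0) : ℕ × ℕ) ≤ e' from zero_le)]; rfl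
    | succ b ih =>
      obtain ⟨a', b'⟩ := e'
      have h : monomialGerm (0, b + 1) * f = lGerm * (monomialGerm (0, b) * f) := by
        simp only [monomialGerm]; ring
      rw [h]
      cases b' with
      | zero => rw [taylorCoeff_lGerm_mul_zero]; simp
      | succ b' => rw [taylorCoeff_lGerm_mul_succ, ih]; simp
  | succ a ih =>
    obtain ⟨a', b'⟩ := e'
    have h : monomialGerm (a + 1, b) * f = xGerm * (monomialGerm (a, b) * f) := by
      simp only [monomialGerm]; ring
    rw [h]
    cases a' with
    | zero => rw [taylorCoeff_xGerm_mul_zero]; simp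
    | succ a' => rw [taylorCoeff_xGerm_mul_succ, ih]; simp

theorem taylorCoeff_one_ne_zero {e : ℕ × ℕ} (h : taylorCoeff 1 e ≠ 0) : e = (0, 0) := by
  have hD : ∀ (D : Derivation ℝ SmoothGerm SmoothGerm) (n : ℕ), D^[n + 1] 1 = 0 := fun D n => by
    rw [Function.iterate_succ_apply, D.map_one_eq_zero, iterate_map_zero]
  obtain ⟨_ | a, _ | b⟩ := e
  · rfl
  all_goals
    rw [taylorCoeff_eq] at h
    simp only [hD, iterate_map_zero, map_zero, zero_div, ne_eq, not_true, Function.iterate_zero,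
      id] at h

theorem taylorCoeff_monomialGerm_self (e : ℕ × ℕ) : taylorCoeff (monomialGerm e) e = 1 := by
  rw [← mul_one (monomialGerm e), taylorCoeff_monomialGerm_mul, if_pos le_rfl, tsub_self]
  exact (taylorCoeff_zero_exponent 1).trans (map_one _)

theorem eq_of_taylorCoeff_monomialGerm_ne_zero {e e' : ℕ × ℕ}
    (h : taylorCoeff (monomialGerm e) e' ≠ 0) : e' = e := by
  rw [← mul_one (monomialGerm e), taylorCoeff_monomialGerm_mul] at h
  split_ifs at h with h1
  · have h2 : e' - e = 0 := taylorCoeff_one_ne_zero h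
    exact le_antisymm (tsub_eq_zero_iff_le.1 h2) h1
  · exact absurd rfl h

theorem monomialGerm_dvd_of_le {e e' : ℕ × ℕ} (h : e ≤ e') : monomialGerm e ∣ monomialGerm e' :=
  ⟨monomialGerm (e' - e), by rw [← monomialGerm_add, add_tsub_cancel_of_le h]⟩

theorem smul_mem_ideal_iff {I : Ideal SmoothGerm} {c : ℝ} (hc : c ≠ 0) {f : SmoothGerm} :
    c • f ∈ I ↔ f ∈ I :=
  (I.restrictScalars ℝ).smul_mem_iff hc

theorem mem_terms_monomialGerm {e : ℕ × ℕ} {p : SmoothGerm} :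
    p ∈ terms (monomialGerm e) ↔ p = monomialGerm e := by
  constructor
  · rintro ⟨e', h, rfl⟩
    rw [eq_of_taylorCoeff_monomialGerm_ne_zero h, taylorCoeff_monomialGerm_self, one_smul]
  · rintro rfl
    exact ⟨e, by rw [taylorCoeff_monomialGerm_self]; simp⟩

/-! ### Hadamard decompositions of germs -/

/-- Here `g` is the whole germ `f(x, 0)`, not a polynomial: this serves a row in which no term is to
be removed. -/
theorem exists_eq_add_lGerm_mul (f : SmoothGerm) :
    ∃ g q, f = g + lGerm * q ∧ ∀ a b, taylorCoeff g (a, b + 1) = 0 := by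
  obtain ⟨u, hu, rfl⟩ := exists_germOf_eq f
  obtain ⟨q, hq, h⟩ := hu.exists_hadamard_snd
  have hg : SmoothNearZero fun p => u (p.1, 0) := by
    filter_upwards [tendsto_fst_zero.eventually hu] with p hp
    exact hp.comp p (contDiffAt_fst.prodMk contDiffAt_const)
  refine ⟨germOf _ hg, germOf q hq, germ_eq_of_eventuallyEq h rfl rfl, fun a b => ?_⟩
  have h0 : Dl (germOf _ hg) = 0 := (Dl_germOf hg).trans
    (germOf_eq_iff.2 (Eventually.of_forall fun p => by simp [derivSnd]) :
      _ = germOf (fun _ => 0) (Eventually.of_forall fun _ => contDiffAt_const))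
  simp [taylorCoeff_eq, h0]

theorem exists_eq_smul_one_add (f : SmoothGerm) :
    ∃ q r, f = evalZero f • 1 + xGerm * q + lGerm * r := by
  obtain ⟨u, hu, rfl⟩ := exists_germOf_eq f
  obtain ⟨r, hr, h⟩ := hu.exists_hadamard_snd
  have hg : SmoothNearZero fun p => u (p.1, 0) := by
    filter_upwards [tendsto_fst_zero.eventually hu] with p hp
    exact hp.comp p (contDiffAt_fst.prodMk contDiffAt_const)
  obtain ⟨q, hq, h'⟩ := hg.exists_hadamard_fst
  refine ⟨germOf q hq, germOf r hr, ?_⟩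
  rw [smul_eq_constGerm_mul, mul_one]
  refine germ_eq_of_eventuallyEq (f := u) (g := fun p => u 0 + p.1 * q p + p.2 * r p) ?_ rfl rfl
  filter_upwards [h, h'] with p h1 h2
  rw [h1, h2]
  rfl

/-! ### Substitutions -/

/-- The ring homomorphism `h(x, l) ↦ h(X(x, l), l)`. -/
def substHom (X : ℝ × ℝ → ℝ) (hX : SmoothNearZero X) (h0 : X 0 = 0) :
    SmoothGerm →+* SmoothGerm where
  toFun h := ⟨Germ.compTendsto h.1 (fun p => (X p, p.2))
      (smoothNearZero_comp (v := 0) (Eventually.of_forall fun _ => contDiffAt_const) hX h0).1, by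
    obtain ⟨_, v, hv, rfl⟩ := h
    exact ⟨_, (smoothNearZero_comp hv hX h0).2, rfl⟩⟩
  map_one' := rfl
  map_zero' := rfl
  map_mul' a b := by
    obtain ⟨f, hf, rfl⟩ := exists_germOf_eq a
    obtain ⟨g, hg, rfl⟩ := exists_germOf_eq b
    rfl
  map_add' a b := by
    obtain ⟨f, hf, rfl⟩ := exists_germOf_eq a
    obtain ⟨g, hg, rfl⟩ := exists_germOf_eq b
    rfl

section substHom

variable {X : ℝ × ℝ → ℝ} (hX : SmoothNearZero X) (h0 : X 0 = 0)

theorem substHom_lGerm : substHom X hX h0 lGerm = lGerm := rfl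

theorem substHom_smul (c : ℝ) (f : SmoothGerm) :
    substHom X hX h0 (c • f) = c • substHom X hX h0 f := by
  rw [smul_eq_constGerm_mul, smul_eq_constGerm_mul, map_mul]
  rfl

theorem IsIntrinsic.substHom_mem {I : Ideal SmoothGerm} (hI : IsIntrinsic I)
    (hpos : ∀ᶠ p in 𝓝 (0 : ℝ × ℝ), 0 < deriv (fun x => X (x, p.2)) p.1) {h : SmoothGerm}
    (hh : h ∈ I) : substHom X hX h0 h ∈ I := by
  obtain ⟨v, hv, rfl⟩ := exists_germOf_eq h
  refine hI _ hh _ ⟨_, v, fun _ => 1, X, rfl, rfl, Eventually.of_forall fun _ => contDiffAt_const,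
    hX, h0, ?_, Eventually.of_forall fun p => (one_mul _).symm⟩
  filter_upwards [hpos] with p hp using ⟨one_pos, hp⟩

end substHom

/-- The factor `S` is harmless in an ideal, so only the substitutions need checking. -/
theorem isIntrinsic_of_substHom {I : Ideal SmoothGerm}
    (hI : ∀ X hX h0, ∀ h ∈ I, substHom X hX h0 h ∈ I) : IsIntrinsic I := by
  rintro h hh g ⟨u, v, S, X, hu, hv, hS, hX, h0, -, he⟩
  obtain ⟨w, hw, rfl⟩ := exists_germOf_eq h
  have h1 : v =ᶠ[𝓝 0] w := Germ.coe_eq.1 hv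
  have : g = germOf S hS * substHom X hX h0 (germOf w hw) := by
    apply Subtype.ext
    rw [← hu]
    apply Germ.coe_eq.2
    filter_upwards [he, (smoothNearZero_comp hw hX h0).1.eventually h1] with p h2 h3
    rw [h2, h3]
    rfl
  rw [this]
  exact I.mul_mem_left _ (hI X hX h0 _ hh)

/-! ### Ideals generated by monomials -/

/-- The exponents of the monomial germs in an ideal. -/
def exponents (I : Ideal SmoothGerm) : Set (ℕ × ℕ) := {e | monomialGerm e ∈ I}

theorem exists_le_of_mem_span_of_taylorCoeff_ne_zero {E : Set (ℕ × ℕ)} {f : SmoothGerm}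
    (hf : f ∈ Ideal.span (monomialGerm '' E)) {e : ℕ × ℕ} (he : taylorCoeff f e ≠ 0) :
    ∃ e₀ ∈ E, e₀ ≤ e := by
  -- The extra multiplier `a` makes the statement stable under the scalar step of the span
  -- induction.
  have key : ∀ a e, taylorCoeff (a * f) e ≠ 0 → ∃ e₀ ∈ E, e₀ ≤ e := by
    clear he
    induction hf using Submodule.span_induction with
    | mem f h =>
      obtain ⟨e₀, h0, rfl⟩ := h
      intro a e he
      rw [mul_comm, taylorCoeff_monomialGerm_mul] at he
      split_ifs at he with h1
      · exact ⟨e₀, h0, h1⟩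
      · exact absurd rfl he
    | zero =>
      intro a e he
      rw [mul_zero, taylorCoeff_zero] at he
      exact absurd rfl he
    | add f g _ _ ihf ihg =>
      intro a e he
      rw [mul_add, taylorCoeff_add] at he
      by_cases h1 : taylorCoeff (a * f) e = 0
      · rw [h1, zero_add] at he
        exact ihg a e he
      · exact ihf a e h1
    | smul b f _ ih =>
      intro a e he
      rw [smul_eq_mul, ← mul_assoc] at he
      exact ih _ e he
  exact key 1 e (by rwa [one_mul])

theorem monomialGerm_mem_of_le {I : Ideal SmoothGerm} {e e' : ℕ × ℕ} (h : monomialGerm e ∈ I)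
    (hle : e ≤ e') : monomialGerm e' ∈ I :=
  I.mem_of_dvd (monomialGerm_dvd_of_le hle) h

theorem monomialGerm_mem_span_iff {E : Set (ℕ × ℕ)} {e : ℕ × ℕ} :
    monomialGerm e ∈ Ideal.span (monomialGerm '' E) ↔ ∃ e₀ ∈ E, e₀ ≤ e := by
  constructor
  · intro h
    exact exists_le_of_mem_span_of_taylorCoeff_ne_zero h
      (by rw [taylorCoeff_monomialGerm_self]; exact one_ne_zero)
  · rintro ⟨e₀, h0, hle⟩
    exact monomialGerm_mem_of_le (Ideal.subset_span ⟨e₀, h0, rfl⟩) hle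

theorem monomialPart_eq (I : Ideal SmoothGerm) :
    monomialPart I = Ideal.span (monomialGerm '' exponents I) := by
  unfold monomialPart
  congr 1
  ext p
  constructor
  · rintro ⟨h, e, rfl⟩
    exact ⟨e, h, rfl⟩
  · rintro ⟨e, h, rfl⟩
    exact ⟨h, e, rfl⟩

theorem monomialPart_le (I : Ideal SmoothGerm) : monomialPart I ≤ I :=
  Ideal.span_le.2 fun _ h => h.1

theorem monomialGerm_mem_monomialPart {I : Ideal SmoothGerm} {e : ℕ × ℕ}
    (h : monomialGerm e ∈ I) : monomialGerm e ∈ monomialPart I :=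
  Ideal.subset_span ⟨h, e, rfl⟩

theorem IsMonomialIdeal.monomialPart_eq_self {I : Ideal SmoothGerm} (hI : IsMonomialIdeal I) :
    monomialPart I = I := by
  obtain ⟨E, rfl⟩ := hI
  refine le_antisymm (monomialPart_le _) (Ideal.span_le.2 ?_)
  rintro _ ⟨e, he, rfl⟩
  exact monomialGerm_mem_monomialPart (Ideal.subset_span ⟨e, he, rfl⟩)

theorem mem_of_mem_terms_of_monomialPart_eq_self {I : Ideal SmoothGerm} (hI : monomialPart I = I)
    {f p : SmoothGerm} (hf : f ∈ I) (hp : p ∈ terms f) : p ∈ I := by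
  obtain ⟨e, he, rfl⟩ := hp
  rw [← hI, monomialPart_eq] at hf
  obtain ⟨e₀, h0, hle⟩ := exists_le_of_mem_span_of_taylorCoeff_ne_zero hf he
  exact (smul_mem_ideal_iff he).2 (monomialGerm_mem_of_le h0 hle)

/-! ### Leading terms and reduced monomial standard bases -/

theorem isLeadingExponent_monomialGerm_iff (ord : LocalOrder) {e e' : ℕ × ℕ} :
    IsLeadingExponent ord (monomialGerm e) e' ↔ e' = e := by
  constructor
  · exact fun h => eq_of_taylorCoeff_monomialGerm_ne_zero h.1
  · rintro rfl
    exact ⟨by rw [taylorCoeff_monomialGerm_self]; exact one_ne_zero,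
      fun e h hne => absurd (eq_of_taylorCoeff_monomialGerm_ne_zero h) hne⟩

theorem leadingTerm_monomialGerm (ord : LocalOrder) (e : ℕ × ℕ) :
    leadingTerm ord (monomialGerm e) = monomialGerm e := by
  have h : ∃ e', IsLeadingExponent ord (monomialGerm e) e' :=
    ⟨e, (isLeadingExponent_monomialGerm_iff ord).2 rfl⟩
  have h1 : h.choose = e := (isLeadingExponent_monomialGerm_iff ord).1 h.choose_spec
  rw [leadingTerm, dif_pos h, h1, taylorCoeff_monomialGerm_self, one_smul]

theorem leadingCoeff_monomialGerm (ord : LocalOrder) (e : ℕ × ℕ) :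
    leadingCoeff ord (monomialGerm e) = 1 := by
  have h : ∃ e', IsLeadingExponent ord (monomialGerm e) e' :=
    ⟨e, (isLeadingExponent_monomialGerm_iff ord).2 rfl⟩
  have h1 : h.choose = e := (isLeadingExponent_monomialGerm_iff ord).1 h.choose_spec
  rw [leadingCoeff, dif_pos h, h1, taylorCoeff_monomialGerm_self]

/-- This dichotomy suffices to place leading terms in a monomial ideal; no leading exponent need be
shown to exist for a general germ. -/
theorem leadingTerm_eq_zero_or_mem_terms (ord : LocalOrder) (f : SmoothGerm) :
    leadingTerm ord f = 0 ∨ leadingTerm ord f ∈ terms f := by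
  unfold leadingTerm
  split_ifs with h
  · exact Or.inr ⟨_, h.choose_spec.1, rfl⟩
  · exact Or.inl rfl

/-- Dickson's lemma: minimal elements form an antichain, and `ℕ × ℕ` is well-quasi-ordered. -/
theorem finite_setOf_minimal (E : Set (ℕ × ℕ)) : {e | Minimal (· ∈ E) e}.Finite :=
  WellQuasiOrderedLE.finite_of_isAntichain (setOfPred_minimal_antichain _)

theorem exists_le_minimal {E : Set (ℕ × ℕ)} {e : ℕ × ℕ} (he : e ∈ E) :
    ∃ e₀ ≤ e, Minimal (· ∈ E) e₀ :=
  exists_minimal_le_of_wellFoundedLT (· ∈ E) e he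

/-- The monomial germs with minimal exponent in `E`. -/
def minimalMonomials (E : Set (ℕ × ℕ)) : Finset SmoothGerm :=
  ((finite_setOf_minimal E).image monomialGerm).toFinset

theorem mem_minimalMonomials {E : Set (ℕ × ℕ)} {p : SmoothGerm} :
    p ∈ minimalMonomials E ↔ ∃ e, Minimal (· ∈ E) e ∧ monomialGerm e = p := by
  simp [minimalMonomials]

theorem span_minimalMonomials (E : Set (ℕ × ℕ)) :
    Ideal.span (minimalMonomials E : Set SmoothGerm) = Ideal.span (monomialGerm '' E) := by
  refine le_antisymm (Ideal.span_mono ?_) (Ideal.span_le.2 ?_)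
  · intro p hp
    obtain ⟨e, he, rfl⟩ := mem_minimalMonomials.1 hp
    exact ⟨e, he.1, rfl⟩
  · rintro _ ⟨e, he, rfl⟩
    obtain ⟨e₀, hle, h0⟩ := exists_le_minimal he
    exact monomialGerm_mem_of_le
      (Ideal.subset_span (mem_minimalMonomials.2 ⟨e₀, h0, rfl⟩)) hle

/-- A monomial is its own leading term, and a monomial ideal contains every term of its elements, so
the leading term ideal is the ideal itself. Minimality of the exponents gives reducedness. -/
theorem isReducedMonomialStandardBasis_minimalMonomials (ord : LocalOrder)
    (E : Set (ℕ × ℕ)) :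
    IsReducedMonomialStandardBasis ord (Ideal.span (monomialGerm '' E)) (minimalMonomials E) := by
  have hlt : ∀ g ∈ minimalMonomials E, leadingTerm ord g = g := by
    intro g hg
    obtain ⟨e, -, rfl⟩ := mem_minimalMonomials.1 hg
    exact leadingTerm_monomialGerm ord e
  refine ⟨⟨⟨span_minimalMonomials E, ?_⟩, ?_, ?_⟩, ?_⟩
  · have himg : leadingTerm ord '' (minimalMonomials E : Set SmoothGerm) = minimalMonomials E :=
      (Set.image_congr hlt).trans (Set.image_id' _)
    rw [himg, span_minimalMonomials]
    refine le_antisymm (Ideal.span_le.2 ?_) (Ideal.span_le.2 ?_)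
    · rintro _ ⟨f, hf, rfl⟩
      rcases leadingTerm_eq_zero_or_mem_terms ord f with h | h
      · rw [h]
        exact Submodule.zero_mem _
      · exact mem_of_mem_terms_of_monomialPart_eq_self
          (IsMonomialIdeal.monomialPart_eq_self ⟨E, rfl⟩) hf h
    · rintro _ ⟨e, he, rfl⟩
      exact Ideal.subset_span
        ⟨monomialGerm e, Ideal.subset_span ⟨e, he, rfl⟩, leadingTerm_monomialGerm ord e⟩
  · intro g hg
    obtain ⟨e, -, rfl⟩ := mem_minimalMonomials.1 hg
    exact leadingCoeff_monomialGerm ord e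
  · intro g hg h hh p hp hdvd
    rw [hlt g hg] at hdvd ⊢
    obtain ⟨e, he, rfl⟩ := mem_minimalMonomials.1 hg
    obtain ⟨e', he', rfl⟩ := mem_minimalMonomials.1 hh
    obtain rfl := mem_terms_monomialGerm.1 hp
    -- Divisibility by a monomial is membership in a principal monomial ideal, hence a comparison of
    -- exponents.
    have hmem : monomialGerm e' ∈ Ideal.span (monomialGerm '' {e}) := by
      rw [Set.image_singleton]
      exact Ideal.mem_span_singleton.2 hdvd
    obtain ⟨_, rfl, hle⟩ := monomialGerm_mem_span_iff.1 hmem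
    obtain rfl := he'.eq_of_le he.1 hle
    exact ⟨rfl, rfl⟩
  · intro g hg
    obtain ⟨e, -, rfl⟩ := mem_minimalMonomials.1 hg
    exact ⟨e, rfl⟩

theorem isReducedMonomialStandardBasis_monomialPart (ord : LocalOrder) (I : Ideal SmoothGerm) :
    IsReducedMonomialStandardBasis ord (monomialPart I) (minimalMonomials (exponents I)) := by
  rw [monomialPart_eq]
  exact isReducedMonomialStandardBasis_minimalMonomials ord _

/-! ### Powers of the maximal ideal -/

theorem xGerm_mem_maxIdeal : xGerm ∈ maxIdeal := Ideal.subset_span (by simp)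

theorem lGerm_mem_maxIdeal : lGerm ∈ maxIdeal := Ideal.subset_span (by simp)

theorem mem_maxIdeal_of_evalZero_eq_zero {f : SmoothGerm} (h : evalZero f = 0) :
    f ∈ maxIdeal := by
  obtain ⟨q, r, hf⟩ := exists_eq_smul_one_add f
  rw [hf, h, zero_smul, zero_add]
  exact add_mem (Ideal.mul_mem_right _ _ xGerm_mem_maxIdeal)
    (Ideal.mul_mem_right _ _ lGerm_mem_maxIdeal)

theorem monomialGerm_mem_maxIdeal_pow (e : ℕ × ℕ) :
    monomialGerm e ∈ maxIdeal ^ (e.1 + e.2) := by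
  rw [pow_add]
  exact Ideal.mul_mem_mul (Ideal.pow_mem_pow xGerm_mem_maxIdeal _)
    (Ideal.pow_mem_pow lGerm_mem_maxIdeal _)

theorem monomialGerm_mem_maxIdeal_pow_of_le {e : ℕ × ℕ} {k : ℕ} (h : k ≤ e.1 + e.2) :
    monomialGerm e ∈ maxIdeal ^ k :=
  Ideal.pow_le_pow_right h (monomialGerm_mem_maxIdeal_pow e)

theorem maxIdeal_pow_eq_span (k : ℕ) :
    maxIdeal ^ k = Ideal.span (monomialGerm '' {e | e.1 + e.2 = k}) := by
  refine le_antisymm ?_ (Ideal.span_le.2 ?_)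
  · induction k with
    | zero =>
      rw [pow_zero, Ideal.one_eq_top]
      refine ((Ideal.eq_top_iff_one _).2 ?_).ge
      rw [← monomialGerm_zero]
      exact Ideal.subset_span ⟨_, rfl, rfl⟩
    | succ k ih =>
      rw [pow_succ']
      refine (Ideal.mul_mono_right ih).trans ?_
      rw [maxIdeal, Ideal.span_mul_span']
      refine Ideal.span_le.2 ?_
      rintro _ ⟨z, hz, _, ⟨e, he, rfl⟩, rfl⟩
      have he' : e.1 + e.2 = k := he
      rcases hz with rfl | rfl
      · refine Ideal.subset_span ⟨(e.1 + 1, e.2), ?_, ?_⟩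
        · change e.1 + 1 + e.2 = k + 1
          omega
        · simp only [monomialGerm]
          ring
      · refine Ideal.subset_span ⟨(e.1, e.2 + 1), ?_, ?_⟩
        · change e.1 + (e.2 + 1) = k + 1
          omega
        · simp only [monomialGerm]
          ring
  · rintro _ ⟨e, rfl, rfl⟩
    exact monomialGerm_mem_maxIdeal_pow e

theorem maxIdeal_pow_mul_span_eq_span (m n : ℕ) :
    maxIdeal ^ m * Ideal.span {lGerm ^ n} =
      Ideal.span (monomialGerm '' {e | n ≤ e.2 ∧ e.1 + e.2 = m + n}) := by
  rw [maxIdeal_pow_eq_span, Ideal.span_mul_span']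
  congr 1
  ext p
  constructor
  · rintro ⟨_, ⟨e, he, rfl⟩, _, rfl, rfl⟩
    have he' : e.1 + e.2 = m := he
    refine ⟨(e.1, e.2 + n), ⟨Nat.le_add_left _ _, ?_⟩, ?_⟩
    · change e.1 + (e.2 + n) = m + n
      omega
    · simp only [monomialGerm]
      ring
  · rintro ⟨⟨a, b⟩, ⟨h1, h2⟩, rfl⟩
    obtain ⟨b, rfl⟩ := Nat.exists_eq_add_of_le h1
    refine ⟨monomialGerm (a, b), ⟨(a, b), ?_, rfl⟩, lGerm ^ n, rfl, ?_⟩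
    · change a + b = m
      dsimp only at h2
      omega
    · simp only [monomialGerm]
      ring

/-- A substitution fixing the origin sends `x` and `λ` to germs vanishing there. Hence the intrinsic
part of a subspace of finite codimension also has finite codimension. -/
theorem isIntrinsic_maxIdeal_pow (k : ℕ) : IsIntrinsic (maxIdeal ^ k) := by
  refine isIntrinsic_of_substHom fun X hX h0 h hh => ?_
  have h1 : maxIdeal.map (substHom X hX h0) ≤ maxIdeal := by
    rw [maxIdeal, Ideal.map_span, Ideal.span_le]
    rintro _ ⟨z, rfl | rfl, rfl⟩
    · exact mem_maxIdeal_of_evalZero_eq_zero h0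
    · exact mem_maxIdeal_of_evalZero_eq_zero rfl
  have h2 := Ideal.mem_map_of_mem (substHom X hX h0) hh
  rw [Ideal.map_pow] at h2
  exact Ideal.pow_right_mono h1 k h2

/-- Taylor's formula by induction: write `f = c + x q + λ r` and expand `q` and `r` to order `k`. -/
theorem maxIdeal_pow_sup_span_eq_top (k : ℕ) :
    (maxIdeal ^ k).restrictScalars ℝ ⊔
      Submodule.span ℝ (monomialGerm '' {e | e.1 + e.2 < k}) = ⊤ := by
  induction k with
  | zero => simp
  | succ k ih =>
    have hz : ∀ z : SmoothGerm, z ∈ maxIdeal →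
        (∀ e : ℕ × ℕ, ∃ e' : ℕ × ℕ, z * monomialGerm e = monomialGerm e' ∧
          e'.1 + e'.2 = e.1 + e.2 + 1) →
        ∀ q, z * q ∈ (maxIdeal ^ (k + 1)).restrictScalars ℝ ⊔
          Submodule.span ℝ (monomialGerm '' {e | e.1 + e.2 < k + 1}) := by
      intro z hz hm q
      have hq : q ∈ (⊤ : Submodule ℝ SmoothGerm) := trivial
      rw [← ih] at hq
      obtain ⟨u, hu, v, hv, rfl⟩ := Submodule.mem_sup.1 hq
      clear hq
      rw [mul_add]
      refine add_mem (Submodule.mem_sup_left ?_) (Submodule.mem_sup_right ?_)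
      · change z * u ∈ maxIdeal ^ (k + 1)
        rw [pow_succ']
        exact Ideal.mul_mem_mul hz hu
      · induction hv using Submodule.span_induction with
        | mem v h =>
          obtain ⟨e, he, rfl⟩ := h
          obtain ⟨e', h1, h2⟩ := hm e
          rw [h1]
          refine Submodule.subset_span ⟨e', ?_, rfl⟩
          change e'.1 + e'.2 < k + 1
          rw [h2]
          exact Nat.succ_lt_succ he
        | zero => rw [mul_zero]; exact Submodule.zero_mem _
        | add v w _ _ hv hw => rw [mul_add]; exact add_mem hv hw
        | smul c v _ hv => rw [mul_smul_comm]; exact Submodule.smul_mem _ _ hv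
    refine eq_top_iff.2 fun f _ => ?_
    obtain ⟨q, r, hf⟩ := exists_eq_smul_one_add f
    rw [hf]
    refine add_mem (add_mem (Submodule.smul_mem _ _ (Submodule.mem_sup_right ?_)) ?_) ?_
    · rw [← monomialGerm_zero]
      exact Submodule.subset_span ⟨_, Nat.succ_pos k, rfl⟩
    · refine hz _ xGerm_mem_maxIdeal (fun e => ⟨(e.1 + 1, e.2), ?_, ?_⟩) q
      · simp only [monomialGerm]
        ring
      · dsimp only
        omega
    · refine hz _ lGerm_mem_maxIdeal (fun e => ⟨(e.1, e.2 + 1), ?_, ?_⟩) r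
      · simp only [monomialGerm]
        ring
      · dsimp only
        omega

/-- Every germ is a polynomial of `x`-degree less than `k`, up to a germ of order at least `k`. -/
theorem exists_sub_sum_mem_maxIdeal_pow (k : ℕ) (f : SmoothGerm) :
    ∃ p : ℕ → Polynomial ℝ,
      f - ∑ a ∈ Finset.range k, xGerm ^ a * Polynomial.aeval lGerm (p a) ∈ maxIdeal ^ k := by
  have hf : f ∈ (⊤ : Submodule ℝ SmoothGerm) := trivial
  rw [← maxIdeal_pow_sup_span_eq_top k] at hf
  obtain ⟨u, hu, v, hv, rfl⟩ := Submodule.mem_sup.1 hf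
  suffices h : ∃ p : ℕ → Polynomial ℝ,
      v = ∑ a ∈ Finset.range k, xGerm ^ a * Polynomial.aeval lGerm (p a) by
    obtain ⟨p, hp⟩ := h
    refine ⟨p, ?_⟩
    rw [← hp, add_sub_cancel_right]
    exact hu
  clear hf
  induction hv using Submodule.span_induction with
  | mem v h =>
    obtain ⟨e, he, rfl⟩ := h
    have he' : e.1 + e.2 < k := he
    refine ⟨fun a => if a = e.1 then Polynomial.X ^ e.2 else 0, ?_⟩
    rw [Finset.sum_eq_single_of_mem e.1 (Finset.mem_range.2 (by omega))]
    · simp [monomialGerm]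
    · intro a _ ha
      simp [ha]
  | zero => exact ⟨0, by simp⟩
  | add v w _ _ hv hw =>
    obtain ⟨p, hp⟩ := hv
    obtain ⟨q, hq⟩ := hw
    exact ⟨p + q, by rw [hp, hq]; simp [mul_add, Finset.sum_add_distrib]⟩
  | smul c v _ hv =>
    obtain ⟨p, hp⟩ := hv
    exact ⟨c • p, by rw [hp]; simp [Finset.smul_sum]⟩

/-! ### Intrinsic ideals and their monomials -/

/-- Evaluate the polynomial in `c` at the nodes `1, …, n` and invert the Vandermonde matrix. Only
positive `c` are allowed because scaling `x` by `c` must keep `X_x > 0`. -/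
theorem mem_of_forall_sum_pow_smul_mem {M : Type*} [AddCommGroup M] [Module ℝ M]
    (W : Submodule ℝ M) (n : ℕ) (v : ℕ → M)
    (h : ∀ c : ℝ, 0 < c → ∑ i ∈ Finset.range n, c ^ i • v i ∈ W) {j : ℕ} (hj : j < n) :
    v j ∈ W := by
  let A : Matrix (Fin n) (Fin n) ℝ := Matrix.vandermonde fun i => (i : ℝ) + 1
  have hA : IsUnit A.det := by
    rw [isUnit_iff_ne_zero, Matrix.det_vandermonde_ne_zero_iff]
    intro i k hik
    simpa [Fin.ext_iff] using hik
  have hrow : ∀ i : Fin n, ∑ k : Fin n, A i k • v k ∈ W := by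
    intro i
    have := h ((i : ℝ) + 1) (by positivity)
    rwa [Finset.sum_range] at this
  have hsum : ∑ i : Fin n, A⁻¹ ⟨j, hj⟩ i • ∑ k : Fin n, A i k • v k = v j := by
    simp_rw [Finset.smul_sum, smul_smul]
    rw [Finset.sum_comm]
    simp_rw [← Finset.sum_smul, ← Matrix.mul_apply, Matrix.nonsing_inv_mul A hA]
    rw [Finset.sum_eq_single_of_mem ⟨j, hj⟩ (Finset.mem_univ _)]
    · simp
    · intro k _ hk
      rw [Matrix.one_apply_ne' hk, zero_smul]
  rw [← hsum]
  exact sum_mem fun i _ => W.smul_mem _ (hrow i)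

/-- If `p ≠ 0`, then `p = λ ^ n * q` with `q(0) ≠ 0`, and `q(λ)` is a unit of the ring of germs. -/
theorem aeval_lGerm_mul_mem_monomialPart {I : Ideal SmoothGerm} {a : ℕ} {p : Polynomial ℝ}
    (h : xGerm ^ a * Polynomial.aeval lGerm p ∈ I) :
    xGerm ^ a * Polynomial.aeval lGerm p ∈ monomialPart I := by
  by_cases hp : p = 0
  · simp [hp]
  obtain ⟨q, hq, h0⟩ := Polynomial.exists_eq_pow_rootMultiplicity_mul_and_not_dvd p hp 0
  rw [map_zero, sub_zero] at hq h0
  generalize Polynomial.rootMultiplicity 0 p = n at hq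
  have hev : evalZero (Polynomial.aeval lGerm q) = q.coeff 0 := by
    have h1 : ∀ q : Polynomial ℝ, evalZero (Polynomial.aeval lGerm q) = q.eval 0 := by
      intro q
      induction q using Polynomial.induction_on' with
      | add p q hp hq => rw [map_add, map_add, hp, hq, Polynomial.eval_add]
      | monomial n c =>
        rw [Polynomial.aeval_monomial, ← Algebra.smul_def, evalZero_smul, map_pow,
          evalZero_lGerm, Polynomial.eval_monomial]
    rw [h1, Polynomial.coeff_zero_eq_eval_zero]
  have hu : IsUnit (Polynomial.aeval lGerm q) := by
    apply isUnit_of_evalZero_ne_zero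
    rwa [hev, ne_eq, ← Polynomial.X_dvd_iff]
  have he : xGerm ^ a * Polynomial.aeval lGerm p =
      monomialGerm (a, n) * Polynomial.aeval lGerm q := by
    rw [hq, map_mul, map_pow, Polynomial.aeval_X, monomialGerm, mul_assoc]
  rw [he] at h ⊢
  exact Ideal.mul_mem_right _ _ (monomialGerm_mem_monomialPart ((I.mul_unit_mem_iff_mem hu).1 h))

/-- An intrinsic ideal of finite codimension is generated by monomials. -/
theorem IsIntrinsic.monomialPart_eq_self {I : Ideal SmoothGerm} (hI : IsIntrinsic I)
    (hfin : HasFiniteCodim (I.restrictScalars ℝ)) : monomialPart I = I := by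
  refine le_antisymm (monomialPart_le I) fun h hh => ?_
  obtain ⟨k, hk⟩ := hfin
  have hk' : maxIdeal ^ k ≤ I := hk
  have hk2 : maxIdeal ^ k ≤ monomialPart I := by
    rw [maxIdeal_pow_eq_span, Ideal.span_le]
    rintro _ ⟨e, he, rfl⟩
    exact monomialGerm_mem_monomialPart (hk' (monomialGerm_mem_maxIdeal_pow_of_le
      (le_of_eq (Eq.symm he))))
  obtain ⟨p, hp⟩ := exists_sub_sum_mem_maxIdeal_pow k h
  have hsum : ∑ a ∈ Finset.range k, xGerm ^ a * Polynomial.aeval lGerm (p a) ∈ I := by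
    have := I.sub_mem hh (hk' hp)
    rwa [sub_sub_cancel] at this
  -- The substitution of `c x` for `x` multiplies the summand of index `a` by `c ^ a`, so the
  -- Vandermonde argument isolates it.
  have hterm : ∀ a < k, xGerm ^ a * Polynomial.aeval lGerm (p a) ∈ I := by
    intro a ha
    refine mem_of_forall_sum_pow_smul_mem (I.restrictScalars ℝ) k
      (fun a => xGerm ^ a * Polynomial.aeval lGerm (p a)) (fun c hc => ?_) ha
    have hX : SmoothNearZero fun q : ℝ × ℝ => c * q.1 :=
      Eventually.of_forall fun _ => contDiffAt_const.mul contDiffAt_fst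
    have h0 : (fun q : ℝ × ℝ => c * q.1) 0 = 0 := by simp
    have hd : ∀ q : ℝ × ℝ, deriv (fun x => c * x) q.1 = c := fun q => by simp
    have hs := hI.substHom_mem hX h0 (Eventually.of_forall fun q => by rw [hd]; exact hc) hsum
    have hx : substHom _ hX h0 xGerm = c • xGerm := by
      rw [smul_eq_constGerm_mul]
      rfl
    have hl : ∀ q : Polynomial ℝ, substHom _ hX h0 (Polynomial.aeval lGerm q) =
        Polynomial.aeval lGerm q := by
      intro q
      induction q using Polynomial.induction_on' with
      | add p q hp hq => rw [map_add, map_add, hp, hq]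
      | monomial n c =>
        rw [Polynomial.aeval_monomial, ← Algebra.smul_def, substHom_smul, map_pow, substHom_lGerm]
    rw [map_sum] at hs
    refine (congrArg (· ∈ I) (Finset.sum_congr rfl fun a _ => ?_)).mp hs
    rw [map_mul, map_pow, hx, hl, smul_pow, smul_mul_assoc]
  have hfinal : ∑ a ∈ Finset.range k, xGerm ^ a * Polynomial.aeval lGerm (p a) ∈
      monomialPart I :=
    sum_mem fun a ha => aeval_lGerm_mul_mem_monomialPart (hterm a (Finset.mem_range.1 ha))
  have := add_mem (hk2 hp) hfinal
  rwa [sub_add_cancel] at this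

/-- Substitute `x + c λ` for `x` and expand in powers of `c`: the coefficient of `c ^ 1` is `(a + 1)
x ^ a λ ^ (b + 1)`. -/
theorem IsIntrinsic.monomialGerm_shift_mem {I : Ideal SmoothGerm} (hI : IsIntrinsic I) {a b : ℕ}
    (h : monomialGerm (a + 1, b) ∈ I) : monomialGerm (a, b + 1) ∈ I := by
  have key := mem_of_forall_sum_pow_smul_mem (I.restrictScalars ℝ) (a + 1 + 1)
    (fun i => lGerm ^ i * xGerm ^ (a + 1 - i) * ((a + 1).choose i : SmoothGerm) * lGerm ^ b)
    (fun c hc => ?_) (j := 1) (by omega)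
  · have he : lGerm ^ 1 * xGerm ^ (a + 1 - 1) * ((a + 1).choose 1 : SmoothGerm) * lGerm ^ b =
        ((a : ℝ) + 1) • monomialGerm (a, b + 1) := by
      rw [smul_eq_constGerm_mul, map_add, map_natCast, map_one, Nat.choose_one_right]
      simp only [monomialGerm, Nat.add_sub_cancel]
      push_cast
      ring
    change lGerm ^ 1 * xGerm ^ (a + 1 - 1) * ((a + 1).choose 1 : SmoothGerm) * lGerm ^ b ∈ I at key
    rw [he] at key
    exact (smul_mem_ideal_iff (by positivity)).1 key
  · have hX : SmoothNearZero fun q : ℝ × ℝ => c * q.2 + q.1 :=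
      Eventually.of_forall fun _ => (contDiffAt_const.mul contDiffAt_snd).add contDiffAt_fst
    have h0 : (fun q : ℝ × ℝ => c * q.2 + q.1) 0 = 0 := by simp
    have hd : ∀ q : ℝ × ℝ, deriv (fun x => c * q.2 + x) q.1 = 1 := fun q => by simp
    have hs := hI.substHom_mem hX h0 (Eventually.of_forall fun q => by rw [hd]; exact one_pos) h
    have hx : substHom _ hX h0 xGerm = c • lGerm + xGerm := by
      rw [smul_eq_constGerm_mul]
      rfl
    change _ ∈ I
    rw [monomialGerm, map_mul, map_pow, map_pow, hx, substHom_lGerm, add_pow, Finset.sum_mul] at hs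
    refine (congrArg (· ∈ I) (Finset.sum_congr rfl fun i _ => ?_)).mp hs
    rw [smul_pow, smul_mul_assoc, smul_mul_assoc, smul_mul_assoc]

theorem IsIntrinsic.monomialGerm_mem {I : Ideal SmoothGerm} (hI : IsIntrinsic I) {e e' : ℕ × ℕ}
    (h : monomialGerm e ∈ I) (h2 : e.2 ≤ e'.2) (hd : e.1 + e.2 ≤ e'.1 + e'.2) :
    monomialGerm e' ∈ I := by
  have key : ∀ j a b : ℕ, monomialGerm (a + j, b) ∈ I → monomialGerm (a, b + j) ∈ I := by
    intro j
    induction j with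
    | zero => exact fun a b h => h
    | succ j ih =>
      intro a b h
      have := ih a (b + 1) (hI.monomialGerm_shift_mem (a := a + j) h)
      rwa [add_assoc, add_comm 1 j] at this
  obtain ⟨a, b⟩ := e
  obtain ⟨a', b'⟩ := e'
  dsimp only at h2 hd
  -- Truncated subtraction: the excess powers of `x` are traded for powers of `λ`, none if `a ≤ a'`.
  refine monomialGerm_mem_of_le (key (a - a') a' b
    (monomialGerm_mem_of_le h ⟨?_, le_rfl⟩)) ⟨le_rfl, ?_⟩
  · dsimp only
    omega
  · dsimp only
    omega

/-! ### Intrinsic presentations -/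

theorem IsIntrinsicPresentation.eq_span {I : Ideal SmoothGerm} {s : ℕ} {m n : Fin s → ℕ}
    (h : IsIntrinsicPresentation I s m n) :
    I = Ideal.span (monomialGerm '' {e | ∃ i, n i ≤ e.2 ∧ e.1 + e.2 = m i + n i}) := by
  rw [h.2.2]
  simp_rw [maxIdeal_pow_mul_span_eq_span]
  rw [← Ideal.span_iUnion, ← Set.image_iUnion]
  congr 2
  ext e
  simp

/-- Suppose an exponent below `(m i, n i)` lies in `I` because of the summand `j`. Comparing
`λ`-exponents gives `j ≤ i`, comparing total degrees gives `i ≤ j`; so the generators of every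
presentation are minimal. -/
theorem intrinsicGenerators_subset (I : Ideal SmoothGerm) :
    intrinsicGenerators I ⊆ minimalMonomials (exponents I) := by
  rintro _ ⟨s, m, n, h, i, rfl⟩
  have hmem : ∀ e, monomialGerm e ∈ I ↔ ∃ e₀ : ℕ × ℕ,
      (∃ i, n i ≤ e₀.2 ∧ e₀.1 + e₀.2 = m i + n i) ∧ e₀ ≤ e := by
    intro e
    rw [h.eq_span]
    exact monomialGerm_mem_span_iff
  refine mem_minimalMonomials.2 ⟨(m i, n i), ⟨(hmem _).2 ⟨_, ⟨i, le_rfl, rfl⟩, le_rfl⟩, ?_⟩, rfl⟩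
  rintro ⟨a, b⟩ he hle
  obtain ⟨⟨a₀, b₀⟩, ⟨j, h1, h2⟩, h3⟩ := (hmem _).1 he
  simp only [Prod.mk_le_mk] at h1 h2 h3 hle ⊢
  have hij : j ≤ i := h.1.le_iff_le.1 (by omega)
  have hji : i ≤ j := h.2.1.le_iff_ge.1 (show m j + n j ≤ m i + n i by omega)
  obtain rfl := le_antisymm hij hji
  omega

/-- The corners of the staircase in the coordinates `(b, a + b)` have first coordinates `n i` and
second coordinates `m i + n i`; being an antichain, they increase in the first and decrease in the
second. -/
theorem IsIntrinsic.exists_presentation {I : Ideal SmoothGerm} (hI : IsIntrinsic I)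
    (hmon : monomialPart I = I) :
    ∃ (s : ℕ) (m n : Fin s → ℕ), IsIntrinsicPresentation I s m n ∧
      (HasFiniteCodim (I.restrictScalars ℝ) → ∃ i, n i = 0) := by
  -- the pairs `(b, a + b)` for the exponents `(a, b)` of the monomials in `I`
  let T : Set (ℕ × ℕ) := {t | t.1 ≤ t.2 ∧ monomialGerm (t.2 - t.1, t.1) ∈ I}
  let N : Finset ℕ := (finite_setOf_minimal T).toFinset.image Prod.fst
  have hN : ∀ b ∈ N, ∃ d, Minimal (· ∈ T) (b, d) := by
    intro b hb
    obtain ⟨⟨b, d⟩, h, rfl⟩ := Finset.mem_image.1 hb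
    exact ⟨d, by simpa using h⟩
  choose! D hD using hN
  let n : Fin N.card → ℕ := N.orderEmbOfFin rfl
  have hn : ∀ i, Minimal (· ∈ T) (n i, D (n i)) := fun i => hD _ (N.orderEmbOfFin_mem rfl i)
  have hn' : ∀ {e : ℕ × ℕ}, monomialGerm e ∈ I →
      ∃ i, n i ≤ e.2 ∧ D (n i) ≤ e.1 + e.2 := by
    intro e he
    have hT : (e.2, e.1 + e.2) ∈ T := by
      refine ⟨Nat.le_add_left _ _, ?_⟩
      simpa using he
    obtain ⟨⟨b, d⟩, hle, hmin⟩ := exists_le_minimal hT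
    have hb : b ∈ N := Finset.mem_image.2 ⟨(b, d), by simpa using hmin, rfl⟩
    obtain ⟨i, hi⟩ : b ∈ Set.range n := by
      rw [N.range_orderEmbOfFin rfl]
      exact hb
    have hdd : D b ≤ d := by
      rcases le_total (D b) d with h | h
      · exact h
      · exact (hD b hb).le_of_le hmin.1 (show ((b, d) : ℕ × ℕ) ≤ (b, D b) from ⟨le_rfl, h⟩) |>.2
    refine ⟨i, ?_⟩
    rw [hi]
    exact ⟨hle.1, hdd.trans hle.2⟩
  have hsum : ∀ i, D (n i) - n i + n i = D (n i) := fun i => Nat.sub_add_cancel (hn i).1.1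
  refine ⟨N.card, fun i => D (n i) - n i, n, ⟨(N.orderEmbOfFin rfl).strictMono, ?_, ?_⟩, ?_⟩
  · intro i j hij
    dsimp only
    rw [hsum, hsum]
    by_contra! hle
    have hlt : n i < n j := (N.orderEmbOfFin rfl).strictMono hij
    have := ((hn j).le_of_le (hn i).1 (show (n i, D (n i)) ≤ (n j, D (n j)) from ⟨hlt.le, hle⟩)).1
    exact absurd hlt (not_lt_of_ge this)
  · simp_rw [maxIdeal_pow_mul_span_eq_span, hsum]
    refine le_antisymm ?_ (iSup_le fun i => Ideal.span_le.2 ?_)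
    · conv_lhs => rw [← hmon, monomialPart_eq]
      refine Ideal.span_le.2 ?_
      rintro _ ⟨e, he, rfl⟩
      obtain ⟨i, h1, h2⟩ := hn' he
      refine Ideal.mem_iSup_of_mem i (monomialGerm_mem_span_iff.2 ?_)
      have h3 : n i ≤ D (n i) := (hn i).1.1
      -- A divisor of total degree `D (n i)`: lower the power of `x`, or take a pure power of `λ`
      -- when the `λ`-exponent alone exceeds that degree.
      by_cases h : e.2 ≤ D (n i)
      · refine ⟨(D (n i) - e.2, e.2), ⟨h1, Nat.sub_add_cancel h⟩, ?_, le_rfl⟩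
        dsimp only
        omega
      · refine ⟨(0, D (n i)), ⟨h3, by simp⟩, zero_le, ?_⟩
        dsimp only
        omega
    · rintro _ ⟨e, ⟨h1, h2⟩, rfl⟩
      refine hI.monomialGerm_mem (hn i).1.2 h1 ?_
      dsimp only
      rw [hsum, h2]
  · rintro ⟨k, hk⟩
    -- The monomial `x ^ k` lies in `I`, and its `λ`-exponent `0` bounds some `n i`.
    obtain ⟨i, h, -⟩ := hn' (e := (k, 0)) (hk (monomialGerm_mem_maxIdeal_pow_of_le le_self_add))
    exact ⟨i, Nat.le_zero.1 h⟩

/-! ### Removing the terms in a monomial ideal -/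

/-- Here `p` is the Taylor polynomial of `f(x, 0)` of degree less than `k`, built by peeling one
constant off the quotient `q` at a time. -/
theorem exists_eq_sum_add_xGerm_pow_mul (k : ℕ) (f : SmoothGerm) :
    ∃ p q r : SmoothGerm, f = p + xGerm ^ k * q + lGerm * r ∧
      ∀ e, taylorCoeff p e ≠ 0 → e.1 < k ∧ e.2 = 0 := by
  induction k with
  | zero =>
    exact ⟨0, f, 0, by simp, fun e h => absurd (taylorCoeff_zero e) h⟩
  | succ k ih =>
    obtain ⟨p, q, r, hf, hp⟩ := ih
    obtain ⟨q', r', hq⟩ := exists_eq_smul_one_add q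
    refine ⟨p + evalZero q • monomialGerm (k, 0), q', r + xGerm ^ k * r', ?_, ?_⟩
    · rw [hf]
      conv_lhs => rw [hq]
      rw [smul_eq_constGerm_mul, smul_eq_constGerm_mul, monomialGerm]
      ring
    · intro e he
      by_cases h : taylorCoeff p e = 0
      · rw [taylorCoeff_add, h, zero_add, taylorCoeff_smul] at he
        rw [eq_of_taylorCoeff_monomialGerm_ne_zero (right_ne_zero_of_mul he)]
        exact ⟨Nat.lt_succ_self k, rfl⟩
      · exact ⟨(hp e h).1.trans (Nat.lt_succ_self k), (hp e h).2⟩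

/-- The terms of a germ whose exponents lie in an upward closed set `E` can be removed by
subtracting a germ in the ideal generated by the monomials with exponents in `E`. -/
theorem exists_sub_mem_span_of_mem (B : ℕ) : ∀ {E : Set (ℕ × ℕ)}, IsUpperSet E → (0, B) ∈ E →
    ∀ f, ∃ g, f - g ∈ Ideal.span (monomialGerm '' E) ∧ ∀ e ∈ E, taylorCoeff g e = 0 := by
  induction B with
  | zero =>
    intro E _ h0 f
    have h1 : Ideal.span (monomialGerm '' E) = ⊤ := by
      rw [Ideal.eq_top_iff_one, ← monomialGerm_zero]
      exact Ideal.subset_span ⟨_, h0, rfl⟩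
    exact ⟨0, by rw [h1]; trivial, fun e _ => taylorCoeff_zero e⟩
  | succ B ih =>
    intro E hE h0 f
    -- The exponents left after one factor `λ` is divided out. They include `(0, B)`, so the
    -- induction hypothesis applies to the cofactor of `λ`.
    let E' : Set (ℕ × ℕ) := {e | (e.1, e.2 + 1) ∈ E}
    have hE' : IsUpperSet E' := fun e e' hle he =>
      hE (show (e.1, e.2 + 1) ≤ (e'.1, e'.2 + 1) from ⟨hle.1, Nat.succ_le_succ hle.2⟩) he
    have hmul : ∀ u ∈ Ideal.span (monomialGerm '' E'),
        lGerm * u ∈ Ideal.span (monomialGerm '' E) := by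
      intro u hu
      induction hu using Submodule.span_induction with
      | mem u h =>
        obtain ⟨e, he, rfl⟩ := h
        refine Ideal.subset_span ⟨(e.1, e.2 + 1), he, ?_⟩
        simp only [monomialGerm]
        ring
      | zero => rw [mul_zero]; exact Submodule.zero_mem _
      | add u v _ _ hu hv => rw [mul_add]; exact add_mem hu hv
      | smul c u _ hu =>
        rw [smul_eq_mul, mul_left_comm]
        exact Ideal.mul_mem_left _ _ hu
    suffices h : ∃ p r, f - (p + lGerm * r) ∈ Ideal.span (monomialGerm '' E) ∧
        (∀ a, (a, 0) ∈ E → taylorCoeff p (a, 0) = 0) ∧ ∀ a b, taylorCoeff p (a, b + 1) = 0 by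
      obtain ⟨p, r, hf, hp, hp'⟩ := h
      obtain ⟨g, hg, hgE⟩ := ih hE' h0 r
      refine ⟨p + lGerm * g, ?_, ?_⟩
      · have h1 : f - (p + lGerm * g) = f - (p + lGerm * r) + lGerm * (r - g) := by ring
        rw [h1]
        exact add_mem hf (hmul _ hg)
      · rintro ⟨a, _ | b⟩ he
        · rw [taylorCoeff_add, taylorCoeff_lGerm_mul_zero, add_zero, hp a he]
        · rw [taylorCoeff_add, taylorCoeff_lGerm_mul_succ, hp', zero_add, hgE (a, b) he]
    -- The row without `λ` is cut at its first exponent in `E`, or kept whole as `f(x, 0)` if it has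
    -- none.
    by_cases hrow : ∃ a, (a, 0) ∈ E
    · classical
      obtain ⟨p, q, r, hf, hp⟩ := exists_eq_sum_add_xGerm_pow_mul (Nat.find hrow) f
      refine ⟨p, r, ?_, ?_, ?_⟩
      · have h1 : f - (p + lGerm * r) = monomialGerm (Nat.find hrow, 0) * q := by
          rw [hf, monomialGerm]
          ring
        rw [h1]
        exact Ideal.mul_mem_right _ _ (Ideal.subset_span ⟨_, Nat.find_spec hrow, rfl⟩)
      · intro a ha
        by_contra h
        exact Nat.find_min hrow (hp _ h).1 ha
      · intro a b
        by_contra h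
        exact Nat.succ_ne_zero b (hp _ h).2
    · obtain ⟨p, r, hf, hp⟩ := exists_eq_add_lGerm_mul f
      refine ⟨p, r, ?_, fun a ha => absurd ⟨a, ha⟩ hrow, hp⟩
      rw [hf, sub_self]
      exact Submodule.zero_mem _

/-- A monomial in `J` of degree `B` forces `λ ^ B ∈ J`, which starts the row-by-row removal; without
monomials in `J` there is nothing to remove. -/
theorem IsIntrinsic.exists_sub_mem {J : Ideal SmoothGerm} (hJ : IsIntrinsic J) (f : SmoothGerm) :
    ∃ g, f - g ∈ J ∧ ∀ e, monomialGerm e ∈ J → taylorCoeff g e = 0 := by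
  by_cases h : ∃ e, monomialGerm e ∈ J
  · obtain ⟨e, he⟩ := h
    obtain ⟨g, h1, h2⟩ := exists_sub_mem_span_of_mem (e.1 + e.2) (E := exponents J)
      (fun e e' hle h => monomialGerm_mem_of_le h hle)
      (hJ.monomialGerm_mem he (Nat.le_add_left _ _) (by simp)) f
    rw [← monomialPart_eq] at h1
    exact ⟨g, monomialPart_le J h1, h2⟩
  · exact ⟨f, by rw [sub_self]; exact J.zero_mem, fun e he => absurd ⟨e, he⟩ h⟩

theorem not_mem_of_mem_terms {J : Ideal SmoothGerm} {g p : SmoothGerm}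
    (hg : ∀ e, monomialGerm e ∈ J → taylorCoeff g e = 0) (hp : p ∈ terms g) : p ∉ J := by
  obtain ⟨e, he, rfl⟩ := hp
  exact fun h => he (hg e ((smul_mem_ideal_iff he).1 h))

theorem not_dvd_of_mem_terms {J : Ideal SmoothGerm} {g p f : SmoothGerm}
    (hg : ∀ e, monomialGerm e ∈ J → taylorCoeff g e = 0) (hp : p ∈ terms g)
    (hf : f ∈ minimalMonomials (exponents J)) : ¬ f ∣ p := by
  obtain ⟨e, he, rfl⟩ := mem_minimalMonomials.1 hf
  exact fun h => not_mem_of_mem_terms hg hp (J.mem_of_dvd h he.1)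

theorem inter_iUnion_terms_eq_empty {J : Ideal SmoothGerm} {r : ℕ} {g : Fin r → SmoothGerm}
    (hg : ∀ i e, monomialGerm e ∈ J → taylorCoeff (g i) e = 0) :
    (J : Set SmoothGerm) ∩ (⋃ i, terms (g i)) = ∅ := by
  refine Set.eq_empty_iff_forall_notMem.2 ?_
  rintro p ⟨hpJ, hp⟩
  obtain ⟨i, hi⟩ := Set.mem_iUnion.1 hp
  exact not_mem_of_mem_terms (hg i) hi hpJ

/-- Generators may be changed modulo `W`. The scalars are general so as to serve both real subspaces
and ideals. -/
theorem sup_span_range_eq_of_sub_mem {R M : Type*} [Ring R] [AddCommGroup M] [Module R M]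
    {W : Submodule R M} {ι : Type*} {v g : ι → M} (h : ∀ i, v i - g i ∈ W) :
    W ⊔ Submodule.span R (Set.range v) = W ⊔ Submodule.span R (Set.range g) := by
  have key : ∀ {v g : ι → M}, (∀ i, v i - g i ∈ W) →
      W ⊔ Submodule.span R (Set.range v) ≤ W ⊔ Submodule.span R (Set.range g) := by
    intro v g h
    refine sup_le le_sup_left (Submodule.span_le.2 ?_)
    rintro _ ⟨i, rfl⟩
    have h1 : v i = (v i - g i) + g i := by abel
    rw [h1]
    exact add_mem (Submodule.mem_sup_left (h i))
      (Submodule.mem_sup_right (Submodule.subset_span ⟨i, rfl⟩))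
  refine le_antisymm (key h) (key fun i => ?_)
  rw [← neg_sub]
  exact W.neg_mem (h i)

theorem HasFiniteCodim.intrinsicPart {V : Submodule ℝ SmoothGerm} (hV : HasFiniteCodim V) :
    HasFiniteCodim ((intrinsicPart V).restrictScalars ℝ) := by
  obtain ⟨k, hk⟩ := hV
  exact ⟨k, (intrinsicPart_isGreatest V).2 ⟨isIntrinsic_maxIdeal_pow k, hk⟩⟩

/-- A subspace which contains a power of the maximal ideal is finitely generated modulo it. -/
theorem exists_eq_maxIdeal_pow_sup_span {V : Submodule ℝ SmoothGerm} {k : ℕ}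
    (hk : (maxIdeal ^ k).restrictScalars ℝ ≤ V) :
    ∃ (r : ℕ) (v : Fin r → SmoothGerm),
      V = (maxIdeal ^ k).restrictScalars ℝ ⊔ Submodule.span ℝ (Set.range v) := by
  let W := Submodule.span ℝ (monomialGerm '' {e : ℕ × ℕ | e.1 + e.2 < k})
  have hfin : (monomialGerm '' {e : ℕ × ℕ | e.1 + e.2 < k}).Finite := by
    refine Set.Finite.image _ ((Set.finite_Iio ((k, k) : ℕ × ℕ)).subset ?_)
    intro e he
    have he' : e.1 + e.2 < k := he
    exact Prod.mk_lt_mk.2 (Or.inl ⟨by omega, by omega⟩)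
  have : FiniteDimensional ℝ W := FiniteDimensional.span_of_finite ℝ hfin
  have hfg : (V ⊓ W).FG := by
    have h1 : FiniteDimensional ℝ (V ⊓ W : Submodule ℝ SmoothGerm) :=
      Submodule.finiteDimensional_of_le inf_le_right
    exact Module.Finite.iff_fg.1 h1
  obtain ⟨r, v, hv⟩ := Submodule.fg_iff_exists_fin_generating_family.1 hfg
  refine ⟨r, v, ?_⟩
  -- Modular law: the power of the maximal ideal lies in `V` and together with `W` spans everything.
  rw [hv, inf_comm, ← sup_inf_assoc_of_le W hk, maxIdeal_pow_sup_span_eq_top, top_inf_eq]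

end SingularityGerms

end

/-! ### Intrinsic ideals, subspaces and finitely generated ideals -/

theorem mainTheorem9 (ord : SingularityGerms.LocalOrder) :
    -- an intrinsic ideal has a reduced monomial standard basis with its intrinsic generators
    (∀ I : Ideal SingularityGerms.SmoothGerm, SingularityGerms.IsIntrinsic I →
      (SingularityGerms.HasFiniteCodim (I.restrictScalars ℝ) ∨
        SingularityGerms.IsMonomialIdeal I) →
      (∃ (s : ℕ) (m n : Fin s → ℕ), SingularityGerms.IsIntrinsicPresentation I s m n ∧
        (SingularityGerms.HasFiniteCodim (I.restrictScalars ℝ) → ∃ i, n i = 0)) ∧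
      ∃ F : Finset SingularityGerms.SmoothGerm,
        SingularityGerms.IsReducedMonomialStandardBasis ord I F ∧
        SingularityGerms.intrinsicGenerators I ⊆ F) ∧
    -- decomposition of a vector subspace of finite codimension
    (∀ V : Submodule ℝ SingularityGerms.SmoothGerm, SingularityGerms.HasFiniteCodim V →
      ∃ (F : Finset SingularityGerms.SmoothGerm) (r : ℕ)
        (g : Fin r → SingularityGerms.SmoothGerm),
        SingularityGerms.IsReducedMonomialStandardBasis ord
          (SingularityGerms.intrinsicPart V) F ∧
        V = (SingularityGerms.intrinsicPart V).restrictScalars ℝ ⊔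
          Submodule.span ℝ (Set.range g) ∧
        (∀ i, ∀ p ∈ SingularityGerms.terms (g i), ∀ f ∈ F, ¬ f ∣ p) ∧
        (SingularityGerms.intrinsicPart V : Set SingularityGerms.SmoothGerm) ∩
          (⋃ i, SingularityGerms.terms (g i)) = ∅) ∧
    -- decomposition of a finitely generated ideal
    (∀ I : Ideal SingularityGerms.SmoothGerm, I.FG →
      ∃ (F : Finset SingularityGerms.SmoothGerm) (r : ℕ)
        (g : Fin r → SingularityGerms.SmoothGerm),
        SingularityGerms.IsReducedMonomialStandardBasis ord
          (SingularityGerms.monomialPart (SingularityGerms.intrinsicPartIdeal I)) F ∧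
        (SingularityGerms.HasFiniteCodim (I.restrictScalars ℝ) ∨
            SingularityGerms.IsMonomialIdeal (SingularityGerms.intrinsicPartIdeal I) →
          SingularityGerms.IsReducedMonomialStandardBasis ord
            (SingularityGerms.intrinsicPartIdeal I) F) ∧
        I = SingularityGerms.intrinsicPartIdeal I ⊔ Ideal.span (Set.range g) ∧
        (∀ i, ∀ p ∈ SingularityGerms.terms (g i), ∀ f ∈ F, ¬ f ∣ p) ∧
        (SingularityGerms.intrinsicPartIdeal I : Set SingularityGerms.SmoothGerm) ∩
          (⋃ i, SingularityGerms.terms (g i)) = ∅) := by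
  open SingularityGerms in
  refine ⟨fun I hI h => ?_, fun V hV => ?_, fun I hfg => ?_⟩
  · have hmon : monomialPart I = I :=
      h.elim hI.monomialPart_eq_self IsMonomialIdeal.monomialPart_eq_self
    refine ⟨hI.exists_presentation hmon, minimalMonomials (exponents I), ?_,
      intrinsicGenerators_subset I⟩
    have hF := isReducedMonomialStandardBasis_monomialPart ord I
    rwa [hmon] at hF
  · have hJ : IsIntrinsic (intrinsicPart V) := (intrinsicPart_isGreatest V).1.1
    have hJV : (intrinsicPart V).restrictScalars ℝ ≤ V := (intrinsicPart_isGreatest V).1.2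
    obtain ⟨k, hk⟩ := hV.intrinsicPart
    have hk' : (maxIdeal ^ k).restrictScalars ℝ ≤ (intrinsicPart V).restrictScalars ℝ := hk
    obtain ⟨r, v, hv⟩ := exists_eq_maxIdeal_pow_sup_span (hk'.trans hJV)
    -- Each generator is replaced by a representative modulo the intrinsic part with no term in it.
    choose g hg hgt using fun i => hJ.exists_sub_mem (v i)
    refine ⟨minimalMonomials (exponents (intrinsicPart V)), r, g, ?_, ?_,
      fun i p hp f hf => not_dvd_of_mem_terms (hgt i) hp hf, inter_iUnion_terms_eq_empty hgt⟩
    · have hF := isReducedMonomialStandardBasis_monomialPart ord (intrinsicPart V)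
      rwa [hJ.monomialPart_eq_self ⟨k, hk⟩] at hF
    · rw [← sup_span_range_eq_of_sub_mem (v := v) (by exact hg)]
      refine le_antisymm ?_ (sup_le hJV ?_)
      · conv_lhs => rw [hv]
        exact sup_le_sup_right hk' _
      · conv_rhs => rw [hv]
        exact le_sup_right
  · have hgr := intrinsicPart_isGreatest (I.restrictScalars ℝ)
    have hJ : IsIntrinsic (intrinsicPartIdeal I) := hgr.1.1
    have hJI : intrinsicPartIdeal I ≤ I := hgr.1.2
    obtain ⟨r, v, hv⟩ := Submodule.fg_iff_exists_fin_generating_family.1 hfg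
    choose g hg hgt using fun i => hJ.exists_sub_mem (v i)
    have hF := isReducedMonomialStandardBasis_monomialPart ord (intrinsicPartIdeal I)
    refine ⟨minimalMonomials (exponents (intrinsicPartIdeal I)), r, g, hF, fun h => ?_, ?_,
      fun i p hp f hf => not_dvd_of_mem_terms (hgt i) hp hf, inter_iUnion_terms_eq_empty hgt⟩
    · have hmon : monomialPart (intrinsicPartIdeal I) = intrinsicPartIdeal I :=
        h.elim (fun h => hJ.monomialPart_eq_self h.intrinsicPart)
          IsMonomialIdeal.monomialPart_eq_self
      rwa [hmon] at hF
    · have h1 := sup_span_range_eq_of_sub_mem hg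
      rw [hv, sup_eq_right.2 hJI] at h1
      exact h1
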